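/- Let $\Bbbk$ be a field and let $(V,c)$ be a braided vector space over $\Bbbk$, that is, $V$ is a $\Bbbk$-vector space (of any dimension) and $c\in \mathrm{GL}(V\otimes V)$ satisfies $(c\otimes \mathrm{id})(\mathrm{id}\otimes c)(c\otimes \mathrm{id})=(\mathrm{id}\otimes c)(c\otimes \mathrm{id})(\mathrm{id}\otimes c)$. A braided subspace is a subspace $W\subseteq V$ with $c(W\otimes W)=W\otimes W$; it is a braided vector space with the restricted braiding. The tensor algebra $T(V)$ is a braided Hopf algebra whose comultiplication $\Delta$ is the algebra map to the braided tensor product $T(V)\otimes T(V)$ with $\Delta(v)=v\otimes 1+1\otimes v$ for $v\in V$. Let $\mathcal J(V)$ be the largest homogeneous Hopf ideal of $T(V)$ that intersects $\Bbbk\oplus V$ trivially; equivalently, the sum of all homogeneous two-sided ideals $I$ of $T(V)$ such that $I\cap(\Bbbk\oplus V)=0$ and $\Delta(I)\subseteq I\otimes T(V)+T(V)\otimes I$. Let $\mathcal B(V)=T(V)/\mathcal J(V)$ be the Nichols algebra of $V$. For a $\Bbbk$-algebra $A$, let $$\operatorname{GKdim} A=\sup_{U}\ \limsup_{n\to\infty}\frac{\log\dim(\Bbbk+U+\dots+U^n)}{\log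 n}\in[0,\infty],$$ the supremum being over the finite-dimensional subspaces $U$ of $A$. For every braided subspace $W$ of $V$ the inclusion $W\subseteq V$ induces an injective algebra map $\mathcal B(W)\hookrightarrow\mathcal B(V)$. We regard $T(W)\subseteq T(V)$ and $\mathcal B(W)\subseteq\mathcal B(V)$ accordingly. Then the following hold. (1) Let $\mathfrak F$ be a family of braided subspaces of $V$ which is filtered (for $U,W\in\mathfrak F$ there is $Z\in\mathfrak F$ with $U\subseteq Z$ and $W\subseteq Z$) and such that $V=\bigcup_{W\in\mathfrak F}W$. Then $$\mathcal J(V)=\bigcup_{W\in\mathfrak F}\mathcal J(W),\qquad \mathcal B(V)=\bigcup_{W\in\mathfrak F}\mathcal B(W),\qquad \operatorname{GKdim}\mathcal B(V)=\sup_{W\in\mathfrak F}\operatorname{GKdim}\mathcal B(W).$$ (2) If $(V,c)$ is locally finite, that is, $V$ is the union of its finite-dimensional braided subspaces and these form a filtered family, then $$\mathcal J(V)=\bigcup_{W}\mathcal J(W),\qquad \mathcal B(V)=\bigcup_{W}\mathcal B(W),\qquad \operatorname{GKdim}\mathcal B(V)=\sup_{W}\operatorname{GKdim}\mathcal B(W),$$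 where $W$ runs over the finite-dimensional braided subspaces of $V$. -/

import Mathlib

open scoped TensorProduct

noncomputable section

/-- A braiding on a `k`-vector space `V`: a linear automorphism `c` of `V ⊗ V` with
`(c ⊗ id)(id ⊗ c)(c ⊗ id) = (id ⊗ c)(c ⊗ id)(id ⊗ c)` on `V ⊗ V ⊗ V`.
A braided vector space is a vector space together with a braiding. -/
structure Braiding (k V : Type*) [Field k] [AddCommGroup V] [Module k V] where
  /-- the underlying automorphism of `V ⊗ V` -/
  toEquiv : (V ⊗[k] V) ≃ₗ[k] (V ⊗[k] V)
  /-- the braid equation; `id ⊗ c` is transported to `(V ⊗ V) ⊗ V` by the associator -/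
  braid_eq :
    toEquiv.toLinearMap.rTensor V ∘ₗ
        ((TensorProduct.assoc k V V V).symm.toLinearMap ∘ₗ toEquiv.toLinearMap.lTensor V ∘ₗ
          (TensorProduct.assoc k V V V).toLinearMap) ∘ₗ
        toEquiv.toLinearMap.rTensor V =
      ((TensorProduct.assoc k V V V).symm.toLinearMap ∘ₗ toEquiv.toLinearMap.lTensor V ∘ₗ
          (TensorProduct.assoc k V V V).toLinearMap) ∘ₗ
        toEquiv.toLinearMap.rTensor V ∘ₗ
        ((TensorProduct.assoc k V V V).symm.toLinearMap ∘ₗ toEquiv.toLinearMap.lTensor V ∘ₗ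
          (TensorProduct.assoc k V V V).toLinearMap)

namespace Braiding

variable {k V : Type*} [Field k] [AddCommGroup V] [Module k V] (c : Braiding k V)

/-! ### Braided subspaces -/

/-- A subspace `W` is a braided subspace if `c (W ⊗ W) = W ⊗ W`, where `W ⊗ W` is regarded as a
subspace of `V ⊗ V`. -/
def IsBraidedSubspace (W : Submodule k V) : Prop :=
  (LinearMap.range (TensorProduct.mapIncl W W)).map c.toEquiv.toLinearMap =
    LinearMap.range (TensorProduct.mapIncl W W)

/-- The braided subspaces of `(V, c)`, partially ordered by inclusion. -/
abbrev BraidedSubspace : Type _ := {W : Submodule k V // c.IsBraidedSubspace W}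

theorem mapIncl_injective (W : Submodule k V) :
    Function.Injective (TensorProduct.mapIncl W W) :=
  TensorProduct.map_injective_of_flat_flat _ _ W.injective_subtype W.injective_subtype

/-- The restriction of `c` to an automorphism of `W ⊗ W`, for a braided subspace `W`. -/
def restrictEquiv (W : c.BraidedSubspace) :
    (W.1 ⊗[k] W.1) ≃ₗ[k] (W.1 ⊗[k] W.1) :=
  (LinearEquiv.ofInjective _ (mapIncl_injective W.1)).trans
    ((c.toEquiv.submoduleMap _).trans
      ((LinearEquiv.ofEq _ _ W.2).trans
        (LinearEquiv.ofInjective _ (mapIncl_injective W.1)).symm))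

theorem mapIncl_restrictEquiv (W : c.BraidedSubspace) (x : W.1 ⊗[k] W.1) :
    TensorProduct.mapIncl W.1 W.1 (c.restrictEquiv W x) =
      c.toEquiv (TensorProduct.mapIncl W.1 W.1 x) :=
  LinearEquiv.ofInjective_symm_apply (f := TensorProduct.mapIncl W.1 W.1)
    (h := mapIncl_injective W.1) _

theorem mapIncl_rTensor (W : c.BraidedSubspace) (x : (W.1 ⊗[k] W.1) ⊗[k] W.1) :
    TensorProduct.map (TensorProduct.mapIncl W.1 W.1) W.1.subtype
        ((c.restrictEquiv W).toLinearMap.rTensor W.1 x) =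
      c.toEquiv.toLinearMap.rTensor V
        (TensorProduct.map (TensorProduct.mapIncl W.1 W.1) W.1.subtype x) := by
  induction x with
  | zero => simp
  | add x y hx hy => simp only [map_add, hx, hy]
  | tmul x y => simp [mapIncl_restrictEquiv]

theorem mapIncl_assoc (W : Submodule k V) (x : (W ⊗[k] W) ⊗[k] W) :
    TensorProduct.map W.subtype (TensorProduct.mapIncl W W) (TensorProduct.assoc k W W W x) =
      TensorProduct.assoc k V V V
        (TensorProduct.map (TensorProduct.mapIncl W W) W.subtype x) := by
  induction x with
  | zero => simp
  | add x y hx hy => simp only [map_add, hx, hy]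
  | tmul x y =>
    induction x with
    | zero => simp
    | add x y hx hy => simp only [TensorProduct.add_tmul, map_add, hx, hy]
    | tmul x z => simp [TensorProduct.mapIncl]

theorem mapIncl_lTensor (W : c.BraidedSubspace) (x : W.1 ⊗[k] (W.1 ⊗[k] W.1)) :
    TensorProduct.map W.1.subtype (TensorProduct.mapIncl W.1 W.1)
        ((c.restrictEquiv W).toLinearMap.lTensor W.1 x) =
      c.toEquiv.toLinearMap.lTensor V
        (TensorProduct.map W.1.subtype (TensorProduct.mapIncl W.1 W.1) x) := by
  induction x with
  | zero => simp
  | add x y hx hy => simp only [map_add, hx, hy]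
  | tmul x y => simp [mapIncl_restrictEquiv]

theorem mapIncl_conj (W : c.BraidedSubspace) (x : (W.1 ⊗[k] W.1) ⊗[k] W.1) :
    TensorProduct.map (TensorProduct.mapIncl W.1 W.1) W.1.subtype
        ((TensorProduct.assoc k W.1 W.1 W.1).symm
          ((c.restrictEquiv W).toLinearMap.lTensor W.1 (TensorProduct.assoc k W.1 W.1 W.1 x))) =
      (TensorProduct.assoc k V V V).symm (c.toEquiv.toLinearMap.lTensor V
        (TensorProduct.assoc k V V V
          (TensorProduct.map (TensorProduct.mapIncl W.1 W.1) W.1.subtype x))) := by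
  rw [LinearEquiv.eq_symm_apply, ← mapIncl_assoc, LinearEquiv.apply_symm_apply,
    mapIncl_lTensor, mapIncl_assoc]

/-- A braided subspace is itself a braided vector space, with the restricted braiding. -/
def restrict (W : c.BraidedSubspace) : Braiding k W.1 where
  toEquiv := c.restrictEquiv W
  braid_eq := by
    apply LinearMap.ext
    intro x
    have hinj : Function.Injective
        (TensorProduct.map (TensorProduct.mapIncl W.1 W.1) W.1.subtype) :=
      TensorProduct.map_injective_of_flat_flat _ _ (mapIncl_injective W.1) W.1.injective_subtype
    apply hinj
    have h := LinearMap.congr_fun c.braid_eq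
      (TensorProduct.map (TensorProduct.mapIncl W.1 W.1) W.1.subtype x)
    simp only [LinearMap.comp_apply, LinearEquiv.coe_coe] at h ⊢
    rw [mapIncl_rTensor, mapIncl_conj, mapIncl_rTensor, h, mapIncl_conj, mapIncl_rTensor,
      mapIncl_conj]

/-- `(V, c)` is locally finite: it is the union of its finite-dimensional braided subspaces, and
these form a filtered family. -/
def IsLocallyFinite : Prop :=
  (∀ v : V, ∃ W : c.BraidedSubspace, FiniteDimensional k W.1 ∧ v ∈ W.1) ∧
    DirectedOn (· ≤ ·) {W : c.BraidedSubspace | FiniteDimensional k W.1}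

/-! ### The tensor algebra as a braided bialgebra -/

/-- The algebra map `T(V) → End(T(V) ⊗ V)ᵒᵖ` which sends `u ∈ V` to `t ⊗ v ↦ t · c(v ⊗ u)`. -/
def braidAux : TensorAlgebra k V →ₐ[k] (Module.End k (TensorAlgebra k V ⊗[k] V))ᵐᵒᵖ :=
  TensorAlgebra.lift k <|
    (MulOpposite.opLinearEquiv k).toLinearMap ∘ₗ
      LinearMap.llcomp k (TensorAlgebra k V ⊗[k] V) (TensorAlgebra k V ⊗[k] (V ⊗[k] V))
          (TensorAlgebra k V ⊗[k] V)
        ((LinearMap.mul' k (TensorAlgebra k V)).rTensor V ∘ₗ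
          (TensorProduct.assoc k (TensorAlgebra k V) (TensorAlgebra k V) V).symm.toLinearMap ∘ₗ
          ((TensorAlgebra.ι k).rTensor V).lTensor (TensorAlgebra k V)) ∘ₗ
      LinearMap.lTensorHom (TensorAlgebra k V) ∘ₗ
      (TensorProduct.mk k V V).flip.compr₂ c.toEquiv.toLinearMap

/-- The extension of the braiding to `V ⊗ T(V) → T(V) ⊗ V`, in curried form. It is determined by
`v ⊗ 1 ↦ 1 ⊗ v` and by the usual hexagon rule `c(id ⊗ m) = (m ⊗ id)(id ⊗ c)(c ⊗ id)`; on
`v ⊗ u₁ ⋯ uₙ` the vector `v` is moved to the right past `u₁`, then past `u₂`, and so on. -/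
def braidTensor : V →ₗ[k] TensorAlgebra k V →ₗ[k] TensorAlgebra k V ⊗[k] V :=
  LinearMap.flip <|
    LinearMap.lcomp k (TensorAlgebra k V ⊗[k] V)
        (TensorProduct.mk k (TensorAlgebra k V) V 1) ∘ₗ
      (MulOpposite.opLinearEquiv k).symm.toLinearMap ∘ₗ c.braidAux.toLinearMap

/-- Left multiplication by `v ⊗ 1 + 1 ⊗ v` on the braided tensor product algebra
`T(V) ⊗ T(V)`, whose product is `(a ⊗ b)(a' ⊗ b') = a c(b ⊗ a') b'`. So `a ⊗ b` is sent to
`v a ⊗ b + ∑ aᵢ ⊗ vᵢ b`, where `c(v ⊗ a) = ∑ aᵢ ⊗ vᵢ`. -/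
def primitiveMul : V →ₗ[k] Module.End k (TensorAlgebra k V ⊗[k] TensorAlgebra k V) :=
  LinearMap.rTensorHom (TensorAlgebra k V) ∘ₗ
      LinearMap.mul k (TensorAlgebra k V) ∘ₗ TensorAlgebra.ι k +
    LinearMap.llcomp k (TensorAlgebra k V ⊗[k] TensorAlgebra k V)
        ((TensorAlgebra k V ⊗[k] V) ⊗[k] TensorAlgebra k V)
        (TensorAlgebra k V ⊗[k] TensorAlgebra k V)
        ((LinearMap.mul' k (TensorAlgebra k V) ∘ₗ
            (TensorAlgebra.ι k).rTensor (TensorAlgebra k V)).lTensor (TensorAlgebra k V) ∘ₗ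
          (TensorProduct.assoc k (TensorAlgebra k V) V (TensorAlgebra k V)).toLinearMap) ∘ₗ
      LinearMap.rTensorHom (TensorAlgebra k V) ∘ₗ c.braidTensor

/-- The comultiplication of the braided Hopf algebra `T(V)`: the algebra map into the braided
tensor product algebra `T(V) ⊗ T(V)` with `v ↦ v ⊗ 1 + 1 ⊗ v`, that is
`Δ(v₁ ⋯ vₙ) = (v₁ ⊗ 1 + 1 ⊗ v₁) ⋯ (vₙ ⊗ 1 + 1 ⊗ vₙ)`. -/
def comul : TensorAlgebra k V →ₗ[k] TensorAlgebra k V ⊗[k] TensorAlgebra k V :=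
  LinearMap.applyₗ (1 ⊗ₜ[k] 1) ∘ₗ (TensorAlgebra.lift k c.primitiveMul).toLinearMap

/-! ### Nichols algebras -/

/-- A two-sided ideal of `T(V)` that is homogeneous, is a coideal, and meets `k ⊕ V` trivially.
(The counit vanishes on such an ideal and the antipode preserves it, as it is homogeneous and
concentrated in degrees at least `2`, so it is a homogeneous Hopf ideal.) -/
structure IsNicholsIdeal (I : Ideal (TensorAlgebra k V)) : Prop where
  isTwoSided : I.IsTwoSided
  isHomogeneous :
    I.IsHomogeneous fun n : ℕ => LinearMap.range (TensorAlgebra.ι k : V →ₗ[k] _) ^ n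
  comul_mem : ∀ x ∈ I, c.comul x ∈
    LinearMap.range ((I.restrictScalars k).subtype.rTensor (TensorAlgebra k V)) ⊔
      LinearMap.range ((I.restrictScalars k).subtype.lTensor (TensorAlgebra k V))
  disjoint : Disjoint (I.restrictScalars k) (1 ⊔ LinearMap.range (TensorAlgebra.ι k))

/-- The ideal `J(V)` of relations of the Nichols algebra: the sum of all homogeneous Hopf ideals
of `T(V)` that meet `k ⊕ V` trivially (the largest such ideal). -/
def relationIdeal : Ideal (TensorAlgebra k V) :=
  sSup {I | c.IsNicholsIdeal I}

instance relationIdeal_isTwoSided : c.relationIdeal.IsTwoSided where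
  mul_mem_of_left {a} b ha := by
    have h : c.relationIdeal ≤
        Submodule.comap (LinearMap.toSpanSingleton (TensorAlgebra k V) (TensorAlgebra k V) b)
          c.relationIdeal := by
      refine sSup_le fun I hI x hx => ?_
      have := hI.isTwoSided
      exact (le_sSup hI : I ≤ _) (I.mul_mem_right b hx)
    exact h ha

/-- The Nichols algebra `B(V) = T(V) / J(V)`. -/
abbrev NicholsAlgebra : Type _ := TensorAlgebra k V ⧸ c.relationIdeal

/-- The canonical map `V → B(V)`. -/
def nicholsι : V →ₗ[k] c.NicholsAlgebra :=
  (Ideal.Quotient.mkₐ k c.relationIdeal).toLinearMap ∘ₗ TensorAlgebra.ι k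

end Braiding

/-- The map `T(W) → T(V)` induced by the inclusion of a subspace `W` of `V`. -/
def TensorAlgebra.inclusion {k V : Type*} [Field k] [AddCommGroup V] [Module k V]
    (W : Submodule k V) : TensorAlgebra k W →ₐ[k] TensorAlgebra k V :=
  TensorAlgebra.lift k (TensorAlgebra.ι k ∘ₗ W.subtype)

/-- The Gelfand-Kirillov dimension of a `k`-algebra `A`: the supremum over the finite-dimensional
subspaces `U` of `A` of `limsup_n log (dim (k + U + ⋯ + Uⁿ)) / log n`. -/
def gelfandKirillovDim (k A : Type*) [Field k] [Ring A] [Algebra k A] : EReal :=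
  ⨆ U : {U : Submodule k A // FiniteDimensional k U},
    Filter.limsup
      (fun n : ℕ => ((Real.log (Module.finrank k ↥(⨆ i ∈ Finset.range (n + 1), U.1 ^ i)) /
        Real.log n : ℝ) : EReal)) Filter.atTop

end

/-! Everything reduces to `J(W) = T(W) ∩ J(V)` for a braided subspace `W`. The definition of `J(V)`
through coideals of `T(V)` does not restrict well, because a Nichols ideal of `T(W)` is no ideal of
`T(V)`. So `J(V)` is first described by skew derivations. Let `leftComul : T(V) → V ⊗ T(V)` be the
part of `Δ` with left factor of degree one; a linear form `f` on `V` gives the skew derivation `∂_f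
= (f ⊗ id) leftComul`. Then `J(V)` is the largest subspace of the augmentation ideal stable under
all `∂_f` (`relationIdeal_eq_skewIdeal`).

One inclusion holds because a Nichols ideal lives in degrees at least two, so only `T(V) ⊗ I`
contributes to `leftComul`. For the other, the largest stable subspace `K` must be a homogeneous
two-sided ideal and coideal. Each property comes from maximality: the candidate (`K + VK`, `K + Kv`,
the homogeneous components of `K`, the contractions of `Δ(K)`) is again stable, hence inside `K`.
Stability rests on twisted Leibniz rules, hexagon rules and coassociativity, all proved by induction
on the first letter.

`leftComul` commutes with `T(W) → T(V)`, and linear forms restrict to `W` and extend from `W`, so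
the description passes to subspaces (`inclusion_mem_skewKernel_iff`). An element of `T(V)` involves
finitely many vectors, hence lies in one `T(W)` of a filtered family; likewise a finite-dimensional
subspace of `B(V)` lies in one `B(W)`. -/

open scoped TensorProduct

noncomputable section

/-! ### Contraction of tensors with linear forms. -/

namespace TensorProduct

variable {k V X Y : Type*} [Field k] [AddCommGroup V] [Module k V]
  [AddCommGroup X] [Module k X] [AddCommGroup Y] [Module k Y]

/-- Contraction of the left factor of `V ⊗ X` with a linear form on `V`. -/
def slice (X : Type*) [AddCommGroup X] [Module k X] (f : Module.Dual k V) :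
    V ⊗[k] X →ₗ[k] X :=
  (TensorProduct.lid k X).toLinearMap ∘ₗ f.rTensor X

@[simp]
theorem slice_tmul (f : Module.Dual k V) (v : V) (x : X) :
    slice X f (v ⊗ₜ[k] x) = f v • x := by
  simp [slice]

theorem slice_lTensor (f : Module.Dual k V) (g : X →ₗ[k] Y) (z : V ⊗[k] X) :
    slice Y f (g.lTensor V z) = g (slice X f z) := by
  induction z with
  | zero => simp
  | add x y hx hy => simp only [map_add, hx, hy]
  | tmul v x => simp

/-- A tensor lies in `V ⊗ M` if and only if all its left contractions lie in `M`. -/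
theorem mem_range_lTensor_iff (M : Submodule k X) (z : V ⊗[k] X) :
    z ∈ LinearMap.range (M.subtype.lTensor V) ↔ ∀ f, slice X f z ∈ M := by
  constructor
  · rintro ⟨y, rfl⟩ f
    rw [slice_lTensor]
    exact (slice M f y).2
  · intro h
    classical
    let b := Module.Basis.ofVectorSpace k V
    obtain ⟨a, rfl⟩ := (equivFinsuppOfBasisLeft (N := X) b).symm.surjective z
    have ha : ∀ i, a i ∈ M := fun i => by
      have := h (b.coord i)
      rwa [show slice X (b.coord i) _ = _ from
        (equivFinsuppOfBasisLeft_apply b _ i).symm, LinearEquiv.apply_symm_apply] at this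
    rw [equivFinsuppOfBasisLeft_symm_apply]
    exact Submodule.sum_mem _ fun i _ => ⟨b i ⊗ₜ ⟨a i, ha i⟩, rfl⟩

end TensorProduct

/-! ### The tensor algebra by recursion on the first letter. -/

namespace TensorAlgebra

variable {k V X : Type*} [Field k] [AddCommGroup V] [Module k V] [AddCommGroup X] [Module k X]

/-- Multiplication `V ⊗ T(V) → T(V)`. -/
def cons (k V : Type*) [Field k] [AddCommGroup V] [Module k V] :
    V ⊗[k] TensorAlgebra k V →ₗ[k] TensorAlgebra k V :=
  LinearMap.mul' k (TensorAlgebra k V) ∘ₗ (ι k).rTensor (TensorAlgebra k V)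

@[simp]
theorem cons_tmul (v : V) (x : TensorAlgebra k V) : cons k V (v ⊗ₜ x) = ι k v * x := by
  simp [cons]

theorem submodule_eq_top (S : Submodule k (TensorAlgebra k V)) (h1 : 1 ∈ S)
    (hS : ∀ v, ∀ x ∈ S, ι k v * x ∈ S) : S = ⊤ := by
  have key : ∀ y : TensorAlgebra k V, ∀ x ∈ S, y * x ∈ S := by
    intro y
    induction y using TensorAlgebra.induction with
    | algebraMap r => intro x hx; rw [← Algebra.smul_def]; exact S.smul_mem r hx
    | ι v => exact hS v
    | mul a b ha hb => intro x hx; rw [mul_assoc]; exact ha _ (hb _ hx)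
    | add a b ha hb => intro x hx; rw [add_mul]; exact S.add_mem (ha _ hx) (hb _ hx)
  exact eq_top_iff.2 fun y _ => by simpa using key y 1 h1

/-- Induction on the first letter: `T(V)` is spanned from `1` by left multiplications by vectors.
This is the induction principle for the recursive identities below. -/
theorem linearMap_ext_cons {f g : TensorAlgebra k V →ₗ[k] X} (h1 : f 1 = g 1)
    (h : ∀ v x, f x = g x → f (ι k v * x) = g (ι k v * x)) (x : TensorAlgebra k V) :
    f x = g x := by
  have := submodule_eq_top (LinearMap.eqLocus f g) h1 h
  exact this.ge (Submodule.mem_top (x := x))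

@[simp]
theorem algebraMapInv_ι (v : V) : algebraMapInv (ι k v) = (0 : k) := by
  simp [algebraMapInv]

/-- The projection of `T(V)` to its component `V` of degree one. -/
def projOne (k V : Type*) [Field k] [AddCommGroup V] [Module k V] :
    TensorAlgebra k V →ₗ[k] V :=
  -- A vector `v` acts on `k × V` by `(r, w) ↦ (0, r • v)`. Products of two vectors act by zero, so
  -- `x` sends `(1, 0)` to its parts of degree zero and one.
  LinearMap.snd k k V ∘ₗ LinearMap.applyₗ ((1, 0) : k × V) ∘ₗ
    (lift k (LinearMap.llcomp k (k × V) V (k × V) (LinearMap.inr k k V) ∘ₗ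
      (LinearMap.lcomp k V (LinearMap.fst k k V)) ∘ₗ
        (LinearMap.ringLmapEquivSelf k k V).symm.toLinearMap) :
      TensorAlgebra k V →ₐ[k] Module.End k (k × V)).toLinearMap

@[simp]
theorem projOne_one : projOne k V 1 = 0 := by simp [projOne]

@[simp]
theorem projOne_ι_mul (v : V) (x : TensorAlgebra k V) :
    projOne k V (ι k v * x) = algebraMapInv x • v := by
  have : LinearMap.fst k k V ∘ₗ LinearMap.applyₗ ((1, 0) : k × V) ∘ₗ
    (lift k (LinearMap.llcomp k (k × V) V (k × V) (LinearMap.inr k k V) ∘ₗ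
      (LinearMap.lcomp k V (LinearMap.fst k k V)) ∘ₗ
        (LinearMap.ringLmapEquivSelf k k V).symm.toLinearMap) :
      TensorAlgebra k V →ₐ[k] Module.End k (k × V)).toLinearMap = algebraMapInv.toLinearMap := by
    ext x
    refine linearMap_ext_cons ?_ ?_ x
    · simp
    · intro v x _
      simp
  have h2 := LinearMap.congr_fun this x
  simp at h2
  simp [projOne, h2]

end TensorAlgebra

/-! ### The braiding on the first two factors, and the braid equation with a spectator. -/

namespace Braiding

open TensorAlgebra

variable {k V : Type*} [Field k] [AddCommGroup V] [Module k V] (c : Braiding k V)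
variable {X Y : Type*} [AddCommGroup X] [Module k X] [AddCommGroup Y] [Module k Y]

/-- The braiding applied to the first two factors of `V ⊗ (V ⊗ X)`. -/
def act (X : Type*) [AddCommGroup X] [Module k X] :
    V ⊗[k] (V ⊗[k] X) →ₗ[k] V ⊗[k] (V ⊗[k] X) :=
  (TensorProduct.assoc k V V X).toLinearMap ∘ₗ c.toEquiv.toLinearMap.rTensor X ∘ₗ
    (TensorProduct.assoc k V V X).symm.toLinearMap

theorem act_tmul (u v : V) (x : X) :
    c.act X (u ⊗ₜ (v ⊗ₜ x)) =
      ((TensorProduct.mk k V X).flip x).lTensor V (c.toEquiv (u ⊗ₜ v)) := by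
  simp only [act, LinearMap.comp_apply, LinearEquiv.coe_coe, TensorProduct.assoc_symm_tmul,
    LinearMap.rTensor_tmul]
  induction c.toEquiv (u ⊗ₜ[k] v) with
  | zero => simp
  | add a b ha hb => simp only [TensorProduct.add_tmul, map_add, ha, hb]
  | tmul a b => simp

theorem act_lTensor (f : X →ₗ[k] Y) (z : V ⊗[k] (V ⊗[k] X)) :
    c.act Y ((f.lTensor V).lTensor V z) = (f.lTensor V).lTensor V (c.act X z) := by
  induction z with
  | zero => simp
  | add x y hx hy => simp only [map_add, hx, hy]
  | tmul u z =>
    induction z with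
    | zero => simp
    | add x y hx hy => simp only [TensorProduct.tmul_add, map_add, hx, hy]
    | tmul v x =>
      simp only [LinearMap.lTensor_tmul, act_tmul]
      induction c.toEquiv (u ⊗ₜ[k] v) with
      | zero => simp
      | add a b ha hb => simp only [map_add, ha, hb]
      | tmul a b => simp

theorem act_braid (z : V ⊗[k] (V ⊗[k] (V ⊗[k] X))) :
    c.act _ ((c.act X).lTensor V (c.act _ z)) =
      (c.act X).lTensor V (c.act _ ((c.act X).lTensor V z)) := by
  induction z with
  | zero => simp
  | add x y hx hy => simp only [map_add, hx, hy]
  | tmul u z =>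
  induction z with
  | zero => simp
  | add x y hx hy => simp only [TensorProduct.tmul_add, map_add, hx, hy]
  | tmul v z =>
  induction z with
  | zero => simp
  | add x y hx hy => simp only [TensorProduct.tmul_add, map_add, hx, hy]
  | tmul w x =>
  let A := TensorProduct.assoc k V V V
  -- `θ` inserts `x` as the last factor, turning `c ⊗ id` and `id ⊗ c` on `V ⊗ V ⊗ V` into the two
  -- actions on `V ⊗ V ⊗ V ⊗ X`.
  let θ : (V ⊗[k] V) ⊗[k] V →ₗ[k] V ⊗[k] (V ⊗[k] (V ⊗[k] X)) :=
    (((TensorProduct.mk k V X).flip x).lTensor V).lTensor V ∘ₗ A.toLinearMap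
  have h1 : ∀ y, θ (c.toEquiv.toLinearMap.rTensor V y) = c.act _ (θ y) := by
    intro y
    induction y with
    | zero => simp
    | add x y hx hy => simp only [map_add, hx, hy]
    | tmul y b =>
    induction y with
    | zero => simp
    | add x y hx hy => simp only [TensorProduct.add_tmul, map_add, hx, hy]
    | tmul a d =>
      simp only [θ, A, LinearMap.comp_apply, LinearEquiv.coe_coe, TensorProduct.assoc_tmul,
        LinearMap.lTensor_tmul, LinearMap.flip_apply, TensorProduct.mk_apply,
        act_tmul, LinearMap.rTensor_tmul]
      induction c.toEquiv (a ⊗ₜ[k] d) with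
      | zero => simp
      | add a b ha hb => simp only [TensorProduct.add_tmul, map_add, ha, hb]
      | tmul a b => simp
  have h2 : ∀ y, θ (A.symm (c.toEquiv.toLinearMap.lTensor V (A y))) =
      (c.act X).lTensor V (θ y) := by
    intro y
    induction y with
    | zero => simp
    | add x y hx hy => simp only [map_add, hx, hy]
    | tmul y b =>
    induction y with
    | zero => simp
    | add x y hx hy => simp only [TensorProduct.add_tmul, map_add, hx, hy]
    | tmul a d =>
      simp [θ, A, act_tmul]
  have h := LinearMap.congr_fun c.braid_eq ((u ⊗ₜ v) ⊗ₜ w)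
  simp only [LinearMap.comp_apply, LinearEquiv.coe_coe] at h
  have h0 : u ⊗ₜ[k] (v ⊗ₜ[k] (w ⊗ₜ[k] x)) = θ ((u ⊗ₜ v) ⊗ₜ w) := by simp [θ, A]
  rw [h0, ← h1, ← h2, ← h1, ← h2, ← h1, ← h2]
  exact congrArg θ h

/-! ### Recursive description of the braiding of `T(V)` and of the comultiplication -/

/-- The braiding `V ⊗ T(V) → T(V) ⊗ V`. -/
def braidLeft : V ⊗[k] TensorAlgebra k V →ₗ[k] TensorAlgebra k V ⊗[k] V :=
  TensorProduct.lift c.braidTensor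

/-- Multiplication `V ⊗ (T(V) ⊗ X) → T(V) ⊗ X`. -/
def consTensor (k V X : Type*) [Field k] [AddCommGroup V] [Module k V]
    [AddCommGroup X] [Module k X] :
    V ⊗[k] (TensorAlgebra k V ⊗[k] X) →ₗ[k] TensorAlgebra k V ⊗[k] X :=
  (cons k V).rTensor X ∘ₗ (TensorProduct.assoc k V (TensorAlgebra k V) X).symm.toLinearMap

@[simp]
theorem consTensor_tmul (v : V) (t : TensorAlgebra k V) (x : X) :
    consTensor k V X (v ⊗ₜ (t ⊗ₜ x)) = (ι k v * t) ⊗ₜ x := by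
  simp [consTensor]

theorem braidTensor_one (v : V) : c.braidTensor v 1 = 1 ⊗ₜ v := by
  simp [braidTensor]

theorem braidAux_ι_tmul (u v : V) (t : TensorAlgebra k V) :
    (c.braidAux (ι k u)).unop (t ⊗ₜ v) =
      (LinearMap.mulLeft k t ∘ₗ ι k).rTensor V (c.toEquiv (v ⊗ₜ u)) := by
  simp only [braidAux, lift_ι_apply]
  simp
  induction c.toEquiv (v ⊗ₜ[k] u) with
  | zero => simp
  | add a b ha hb => simp only [TensorProduct.tmul_add, map_add, ha, hb]
  | tmul a b => simp

/-- The operators of `braidAux` append letters on the right of the `T(V)` factor, so they commute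
with multiplication on its left. This lets the letters already passed be pulled out in front. -/
theorem braidAux_mulLeft (x s : TensorAlgebra k V) : ∀ z : TensorAlgebra k V ⊗[k] V,
    (c.braidAux x).unop ((LinearMap.mulLeft k s).rTensor V z) =
      (LinearMap.mulLeft k s).rTensor V ((c.braidAux x).unop z) := by
  induction x using TensorAlgebra.induction with
  | algebraMap r => intro z; simp [Algebra.algebraMap_eq_smul_one]
  | mul a b ha hb => intro z; simp [ha, hb]
  | add a b ha hb => intro z; simp [ha, hb]
  | ι u =>
    intro z
    induction z with
    | zero => simp
    | add a b ha hb => simp only [map_add, ha, hb]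
    | tmul t v =>
      simp only [LinearMap.rTensor_tmul, braidAux_ι_tmul, LinearMap.mulLeft_apply,
        ← LinearMap.comp_apply, ← LinearMap.rTensor_comp, ← LinearMap.comp_assoc]
      rw [LinearMap.mulLeft_mul]

/-- Moving `v` past `u x` means moving it past `u` and then past `x`; this is the hexagon rule as a
recursion on the first letter. -/
theorem braidLeft_cons (z : V ⊗[k] (V ⊗[k] TensorAlgebra k V)) :
    c.braidLeft ((cons k V).lTensor V z) =
      consTensor k V V (c.braidLeft.lTensor V (c.act _ z)) := by
  induction z with
  | zero => simp
  | add x y hx hy => simp only [map_add, hx, hy]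
  | tmul v z =>
  induction z with
  | zero => simp
  | add x y hx hy => simp only [TensorProduct.tmul_add, map_add, hx, hy]
  | tmul u x =>
    -- Since `braidAux` takes values in the opposite algebra, the operator of the first letter `u`
    -- acts first.
    have : c.braidTensor v (ι k u * x) =
        (c.braidAux x).unop ((ι k).rTensor V (c.toEquiv (v ⊗ₜ u))) := by
      have h := c.braidAux_ι_tmul u v 1
      simp only [LinearMap.mulLeft_one, LinearMap.id_comp] at h
      simp [braidTensor, h]
    simp only [LinearMap.lTensor_tmul, cons_tmul, braidLeft, TensorProduct.lift.tmul, this,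
      act_tmul]
    induction c.toEquiv (v ⊗ₜ[k] u) with
    | zero => simp
    | add a b ha hb => simp only [map_add, ha, hb]
    | tmul a b =>
      have h := c.braidAux_mulLeft x (ι k a) (1 ⊗ₜ b)
      simp only [LinearMap.rTensor_tmul, LinearMap.mulLeft_apply, mul_one] at h
      have h2 : (c.braidAux x).unop (1 ⊗ₜ b) = c.braidTensor b x := by simp [braidTensor]
      simp only [LinearMap.rTensor_tmul, h, h2, LinearMap.lTensor_tmul, LinearMap.flip_apply,
        TensorProduct.mk_apply, TensorProduct.lift.tmul]
      induction c.braidTensor b x with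
      | zero => simp
      | add a b ha hb => simp only [TensorProduct.tmul_add, map_add, ha, hb]
      | tmul a b => simp

end Braiding

namespace Braiding

open TensorAlgebra TensorProduct

variable {k V : Type*} [Field k] [AddCommGroup V] [Module k V] (c : Braiding k V)
variable {X Y : Type*} [AddCommGroup X] [Module k X] [AddCommGroup Y] [Module k Y]

@[simp]
theorem braidLeft_tmul_one (v : V) : c.braidLeft (v ⊗ₜ 1) = 1 ⊗ₜ v := by
  simp [braidLeft, braidTensor_one]

theorem braidLeft_tmul_ι_mul (v u : V) (x : TensorAlgebra k V) :
    c.braidLeft (v ⊗ₜ (ι k u * x)) = consTensor k V V (c.braidLeft.lTensor V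
      (((TensorProduct.mk k V _).flip x).lTensor V (c.toEquiv (v ⊗ₜ u)))) := by
  have := c.braidLeft_cons (v ⊗ₜ (u ⊗ₜ x))
  rwa [LinearMap.lTensor_tmul, cons_tmul, act_tmul] at this

/-- Left multiplication by `1 ⊗ v` on the braided tensor product `T(V) ⊗ T(V)`. -/
def braidCons : V ⊗[k] (TensorAlgebra k V ⊗[k] TensorAlgebra k V) →ₗ[k]
    TensorAlgebra k V ⊗[k] TensorAlgebra k V :=
  (cons k V).lTensor (TensorAlgebra k V) ∘ₗ
    (TensorProduct.assoc k (TensorAlgebra k V) V (TensorAlgebra k V)).toLinearMap ∘ₗ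
    c.braidLeft.rTensor (TensorAlgebra k V) ∘ₗ
    (TensorProduct.assoc k V (TensorAlgebra k V) (TensorAlgebra k V)).symm.toLinearMap

theorem braidCons_tmul (v : V) (a b : TensorAlgebra k V) :
    c.braidCons (v ⊗ₜ (a ⊗ₜ b)) =
      (cons k V ∘ₗ (TensorProduct.mk k V _).flip b).lTensor _ (c.braidLeft (v ⊗ₜ a)) := by
  simp only [braidCons, LinearMap.comp_apply, LinearEquiv.coe_coe, assoc_symm_tmul,
    LinearMap.rTensor_tmul]
  induction c.braidLeft (v ⊗ₜ[k] a) with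
  | zero => simp
  | add x y hx hy => simp only [add_tmul, map_add, hx, hy]
  | tmul s t => simp

theorem primitiveMul_apply (v : V) (z : TensorAlgebra k V ⊗[k] TensorAlgebra k V) :
    c.primitiveMul v z = consTensor k V _ (v ⊗ₜ z) + c.braidCons (v ⊗ₜ z) := by
  induction z with
  | zero => simp
  | add x y hx hy =>
    simp only [tmul_add, map_add, hx, hy]
    abel
  | tmul a b => simp [primitiveMul, braidCons, cons, braidLeft]

@[simp]
theorem comul_one : c.comul 1 = 1 ⊗ₜ 1 := by
  simp [comul]

theorem comul_ι_mul (v : V) (x : TensorAlgebra k V) :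
    c.comul (ι k v * x) =
      consTensor k V _ (v ⊗ₜ c.comul x) + c.braidCons (v ⊗ₜ c.comul x) := by
  rw [← primitiveMul_apply]
  simp [comul]

/-- The braiding preserves the degree of the `T(V)` factor. This and the next lemma give its parts
of degree zero and one, as needed for the recursion of `leftComul`. -/
theorem algebraMapInv_rTensor_braidLeft (v : V) (x : TensorAlgebra k V) :
    slice V algebraMapInv.toLinearMap (c.braidLeft (v ⊗ₜ x)) = algebraMapInv x • v := by
  refine linearMap_ext_cons (f := slice V algebraMapInv.toLinearMap ∘ₗ c.braidLeft ∘ₗ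
    TensorProduct.mk k V _ v) (g := algebraMapInv.toLinearMap.smulRight v) ?_ ?_ x
  · simp
  · intro u x _
    simp only [LinearMap.comp_apply, TensorProduct.mk_apply, braidLeft_tmul_ι_mul]
    have : ∀ z, slice V algebraMapInv.toLinearMap (consTensor k V V z) = 0 := by
      intro z
      induction z with
      | zero => simp
      | add x y hx hy => simp only [map_add, hx, hy, add_zero]
      | tmul v z =>
      induction z with
      | zero => simp
      | add x y hx hy => simp only [tmul_add, map_add, hx, hy, add_zero]
      | tmul t x => simp
    simp [this]

theorem projOne_rTensor_braidLeft (v : V) (x : TensorAlgebra k V) :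
    (projOne k V).rTensor V (c.braidLeft (v ⊗ₜ x)) = c.toEquiv (v ⊗ₜ projOne k V x) := by
  refine linearMap_ext_cons (f := (projOne k V).rTensor V ∘ₗ c.braidLeft ∘ₗ
    TensorProduct.mk k V _ v) (g := c.toEquiv.toLinearMap ∘ₗ TensorProduct.mk k V _ v ∘ₗ
      projOne k V) ?_ ?_ x
  · simp
  · intro u x _
    simp only [LinearMap.comp_apply, TensorProduct.mk_apply, braidLeft_tmul_ι_mul,
      projOne_ι_mul, LinearEquiv.coe_coe, map_smul]
    have h : ∀ z, (projOne k V).rTensor V (consTensor k V V z) =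
        (slice V algebraMapInv.toLinearMap).lTensor V z := by
      intro z
      induction z with
      | zero => simp
      | add x y hx hy => simp only [map_add, hx, hy]
      | tmul v z =>
      induction z with
      | zero => simp
      | add x y hx hy => simp only [tmul_add, map_add, hx, hy]
      | tmul t x => simp [smul_tmul]
    rw [h]
    induction c.toEquiv (v ⊗ₜ[k] u) with
    | zero => simp
    | add x y hx hy => simp only [smul_add, map_add, hx, hy]
    | tmul t y => simp [algebraMapInv_rTensor_braidLeft]

/-- The counit axiom `(ε ⊗ id) Δ = id`. -/
theorem counit_comul (x : TensorAlgebra k V) :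
    slice _ algebraMapInv.toLinearMap (c.comul x) = x := by
  refine linearMap_ext_cons (f := slice _ algebraMapInv.toLinearMap ∘ₗ c.comul)
    (g := LinearMap.id) ?_ ?_ x
  · simp
  · intro v x hx
    simp only [LinearMap.comp_apply, LinearMap.id_apply] at hx ⊢
    have h : ∀ z, slice _ algebraMapInv.toLinearMap
        (consTensor k V (TensorAlgebra k V) (v ⊗ₜ z) + c.braidCons (v ⊗ₜ z)) =
          ι k v * slice _ algebraMapInv.toLinearMap z := by
      intro z
      induction z with
      | zero => simp
      | add x y hx hy =>
        simp only [tmul_add, map_add, mul_add] at hx hy ⊢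
        rw [← hx, ← hy]
        abel
      | tmul a b =>
        rw [map_add, braidCons_tmul, slice_lTensor, algebraMapInv_rTensor_braidLeft]
        simp
    rw [comul_ι_mul, h, hx]

/-! ### Twisted Leibniz rule, hexagon rule and coassociativity for `leftComul`. -/

/-- The component `T(V) → V ⊗ T(V)` of the comultiplication. -/
def leftComul : TensorAlgebra k V →ₗ[k] V ⊗[k] TensorAlgebra k V :=
  (projOne k V).rTensor _ ∘ₗ c.comul

@[simp]
theorem leftComul_one : c.leftComul 1 = 0 := by simp [leftComul]

/-- In `(v ⊗ 1 + 1 ⊗ v) Δ(x)` the first summand needs the part of `Δ(x)` with left degree zero,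
which is `1 ⊗ x` by the counit axiom. In the second, `v` is braided past the degree-one left factors
of `Δ(x)`. -/
theorem leftComul_ι_mul (v : V) (x : TensorAlgebra k V) :
    c.leftComul (ι k v * x) =
      v ⊗ₜ x + (cons k V).lTensor V (c.act _ (v ⊗ₜ c.leftComul x)) := by
  have h : ∀ z, (projOne k V).rTensor (TensorAlgebra k V)
        (consTensor k V (TensorAlgebra k V) (v ⊗ₜ z) + c.braidCons (v ⊗ₜ z)) =
      v ⊗ₜ slice _ algebraMapInv.toLinearMap z +
        (cons k V).lTensor V (c.act _ (v ⊗ₜ (projOne k V).rTensor _ z)) := by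
    intro z
    induction z with
    | zero => simp
    | add x y hx hy =>
      simp only [tmul_add, map_add] at hx hy ⊢
      rw [add_add_add_comm, hx, hy]
      abel
    | tmul a b =>
      have hcomm := LinearMap.congr_fun ((LinearMap.rTensor_comp_lTensor _ (projOne k V)
        (cons k V ∘ₗ (TensorProduct.mk k V _).flip b)).trans
          (LinearMap.lTensor_comp_rTensor _ _ _).symm) (c.braidLeft (v ⊗ₜ a))
      simp only [LinearMap.comp_apply (LinearMap.rTensor _ _),
        LinearMap.comp_apply (LinearMap.lTensor _ _)] at hcomm
      rw [map_add, braidCons_tmul, hcomm, projOne_rTensor_braidLeft, LinearMap.rTensor_tmul,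
        act_tmul, ← LinearMap.lTensor_comp_apply]
      simp [smul_tmul]
  simp only [leftComul, LinearMap.comp_apply, comul_ι_mul, h, counit_comul]

theorem leftComul_cons (z : V ⊗[k] TensorAlgebra k V) :
    c.leftComul (cons k V z) =
      z + (cons k V).lTensor V (c.act _ (c.leftComul.lTensor V z)) := by
  induction z with
  | zero => simp
  | add x y hx hy =>
    simp only [map_add, hx, hy]
    abel
  | tmul v x => simp [leftComul_ι_mul]

/-- The map `leftComul ⊗ id : T(V) ⊗ X → V ⊗ (T(V) ⊗ X)`. -/
def leftComulTensor (X : Type*) [AddCommGroup X] [Module k X] :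
    TensorAlgebra k V ⊗[k] X →ₗ[k] V ⊗[k] (TensorAlgebra k V ⊗[k] X) :=
  (TensorProduct.assoc k V (TensorAlgebra k V) X).toLinearMap ∘ₗ c.leftComul.rTensor X

theorem leftComulTensor_tmul (t : TensorAlgebra k V) (x : X) :
    c.leftComulTensor X (t ⊗ₜ x) = ((TensorProduct.mk k _ X).flip x).lTensor V (c.leftComul t) := by
  simp only [leftComulTensor, LinearMap.comp_apply, LinearMap.rTensor_tmul, LinearEquiv.coe_coe]
  induction c.leftComul t with
  | zero => simp
  | add x y hx hy => simp only [add_tmul, map_add, hx, hy]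
  | tmul v x => simp

theorem leftComulTensor_consTensor (z : V ⊗[k] (TensorAlgebra k V ⊗[k] X)) :
    c.leftComulTensor X (consTensor k V X z) =
      z + (consTensor k V X).lTensor V (c.act _ ((c.leftComulTensor X).lTensor V z)) := by
  induction z with
  | zero => simp
  | add x y hx hy =>
    simp only [map_add, hx, hy]
    abel
  | tmul v z =>
  induction z with
  | zero => simp
  | add x y hx hy =>
    simp only [tmul_add, map_add, hx, hy]
    abel
  | tmul t x =>
    have hc : consTensor k V X ∘ₗ ((TensorProduct.mk k _ X).flip x).lTensor V =
        (TensorProduct.mk k _ X).flip x ∘ₗ cons k V := by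
      ext v t; simp
    rw [consTensor_tmul, leftComulTensor_tmul, leftComul_ι_mul, map_add,
      LinearMap.lTensor_tmul, LinearMap.lTensor_tmul, leftComulTensor_tmul]
    congr 1
    have h := c.act_lTensor ((TensorProduct.mk k _ X).flip x) (v ⊗ₜ c.leftComul t)
    rw [LinearMap.lTensor_tmul] at h
    rw [h]
    simp only [← LinearMap.lTensor_comp_apply, hc]

/-- The hexagon rule relating the braiding `V ⊗ T(V) → T(V) ⊗ V` and `leftComul`. -/
theorem leftComulTensor_braidLeft (v : V) (x : TensorAlgebra k V) :
    c.leftComulTensor V (c.braidLeft (v ⊗ₜ x)) =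
      c.braidLeft.lTensor V (c.act _ (v ⊗ₜ c.leftComul x)) := by
  -- The claim is curried so that the induction covers all `v` at once: passing the first letter
  -- replaces `v` by the other vectors occurring in `c (v ⊗ u)`.
  suffices h : (LinearMap.llcomp k _ _ _ (c.leftComulTensor V ∘ₗ c.braidLeft) ∘ₗ
        (TensorProduct.mk k V (TensorAlgebra k V)).flip) x =
      (LinearMap.llcomp k _ _ _ (c.braidLeft.lTensor V ∘ₗ c.act _) ∘ₗ
        (TensorProduct.mk k V _).flip ∘ₗ c.leftComul) x from LinearMap.congr_fun h v
  refine linearMap_ext_cons ?_ ?_ x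
  · ext v
    simp [leftComulTensor_tmul]
  · intro u x hx
    replace hx : (c.leftComulTensor V ∘ₗ c.braidLeft) ∘ₗ
        (TensorProduct.mk k V (TensorAlgebra k V)).flip x =
        (c.braidLeft.lTensor V ∘ₗ c.act _) ∘ₗ (TensorProduct.mk k V _).flip (c.leftComul x) := hx
    have hs : ∀ s : V ⊗[k] V, (c.leftComulTensor V).lTensor V (c.braidLeft.lTensor V
        (((TensorProduct.mk k V _).flip x).lTensor V s)) =
        (c.braidLeft.lTensor V).lTensor V ((c.act _).lTensor V
          (((TensorProduct.mk k V _).flip (c.leftComul x)).lTensor V s)) := by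
      intro s
      simp only [← LinearMap.lTensor_comp_apply, ← LinearMap.comp_assoc] at hx ⊢
      rw [hx]
    have hB : ∀ y, c.braidLeft.lTensor V (((cons k V).lTensor V).lTensor V y) =
        (consTensor k V V).lTensor V ((c.braidLeft.lTensor V).lTensor V
          ((c.act _).lTensor V y)) := by
      intro y
      have : c.braidLeft ∘ₗ (cons k V).lTensor V =
          consTensor k V V ∘ₗ c.braidLeft.lTensor V ∘ₗ c.act _ :=
        LinearMap.ext c.braidLeft_cons
      simp only [← LinearMap.lTensor_comp_apply, this]
    refine LinearMap.ext fun v => ?_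
    change c.leftComulTensor V (c.braidLeft (v ⊗ₜ (ι k u * x))) =
      c.braidLeft.lTensor V (c.act _ (v ⊗ₜ c.leftComul (ι k u * x)))
    have hn := c.act_lTensor (cons k V) (v ⊗ₜ c.act _ (u ⊗ₜ c.leftComul x))
    rw [LinearMap.lTensor_tmul] at hn
    -- Both sides split by the Leibniz rule. The leading terms agree at once, and the remaining ones
    -- agree by the braid equation `act_braid`.
    rw [braidLeft_tmul_ι_mul, leftComulTensor_consTensor, hs, act_lTensor, leftComul_ι_mul,
      tmul_add, map_add, map_add, hn, hB, ← act_tmul, ← act_tmul, act_braid,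
      LinearMap.lTensor_tmul]

/-- Multiplying by `1 ⊗ v` braids `v` past the left factor only, so the hexagon rule carries over
with the right factor as a spectator. -/
theorem leftComulTensor_braidCons (z : V ⊗[k] (TensorAlgebra k V ⊗[k] TensorAlgebra k V)) :
    c.leftComulTensor _ (c.braidCons z) =
      c.braidCons.lTensor V (c.act _ ((c.leftComulTensor _).lTensor V z)) := by
  induction z with
  | zero => simp
  | add x y hx hy => simp only [map_add, hx, hy]
  | tmul v z =>
  induction z with
  | zero => simp
  | add x y hx hy => simp only [tmul_add, map_add, hx, hy]
  | tmul a b =>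
    have h1 : ∀ w, c.leftComulTensor _ ((cons k V ∘ₗ (TensorProduct.mk k V _).flip b).lTensor _ w) =
        ((cons k V ∘ₗ (TensorProduct.mk k V _).flip b).lTensor _).lTensor V
          (c.leftComulTensor V w) := by
      intro w
      induction w with
      | zero => simp
      | add x y hx hy => simp only [map_add, hx, hy]
      | tmul t u =>
        rw [LinearMap.lTensor_tmul, leftComulTensor_tmul, leftComulTensor_tmul,
          ← LinearMap.lTensor_comp_apply]
        rfl
    have h2 : (cons k V ∘ₗ (TensorProduct.mk k V _).flip b).lTensor _ ∘ₗ c.braidLeft =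
        c.braidCons ∘ₗ ((TensorProduct.mk k (TensorAlgebra k V) _).flip b).lTensor V := by
      ext u t
      simp [braidCons_tmul]
    have hn := c.act_lTensor ((TensorProduct.mk k (TensorAlgebra k V) _).flip b)
      (v ⊗ₜ c.leftComul a)
    rw [LinearMap.lTensor_tmul] at hn
    rw [braidCons_tmul, h1, leftComulTensor_braidLeft, LinearMap.lTensor_tmul,
      leftComulTensor_tmul, hn, ← LinearMap.lTensor_comp_apply, ← LinearMap.lTensor_comp_apply, h2]

/-- The component of coassociativity with values in `V ⊗ T(V) ⊗ T(V)`. -/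
theorem leftComulTensor_comul (x : TensorAlgebra k V) :
    c.leftComulTensor _ (c.comul x) = c.comul.lTensor V (c.leftComul x) := by
  refine linearMap_ext_cons (f := c.leftComulTensor _ ∘ₗ c.comul)
    (g := c.comul.lTensor V ∘ₗ c.leftComul) ?_ ?_ x
  · simp [leftComulTensor_tmul]
  · intro v x hx
    simp only [LinearMap.comp_apply] at hx ⊢
    have h : c.comul ∘ₗ cons k V = (consTensor k V _ + c.braidCons) ∘ₗ c.comul.lTensor V := by
      ext v x
      simp [comul_ι_mul]
    have hn := c.act_lTensor c.comul (v ⊗ₜ c.leftComul x)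
    rw [LinearMap.lTensor_tmul] at hn
    rw [comul_ι_mul, map_add, leftComulTensor_consTensor, leftComulTensor_braidCons,
      leftComul_ι_mul, map_add, LinearMap.lTensor_tmul, LinearMap.lTensor_tmul, hx,
      ← LinearMap.lTensor_comp_apply, h, LinearMap.lTensor_comp_apply, hn, add_assoc,
      LinearMap.lTensor_add, LinearMap.add_apply]

/-! ### The braiding `T(V) ⊗ V → V ⊗ T(V)` -/

/-- The algebra map `T(V) → End(V ⊗ T(V))` sending `u ∈ V` to `v ⊗ t ↦ c(u ⊗ v) t`. -/
def braidRightAux : TensorAlgebra k V →ₐ[k] Module.End k (V ⊗[k] TensorAlgebra k V) :=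
  TensorAlgebra.lift k (LinearMap.llcomp k _ _ _ ((cons k V).lTensor V ∘ₗ c.act _) ∘ₗ
    TensorProduct.mk k V _)

/-- The braiding `T(V) → V ⊗ T(V)`, `x ↦ c(x ⊗ v)`, for a fixed `v ∈ V`. -/
def braidRight (v : V) : TensorAlgebra k V →ₗ[k] V ⊗[k] TensorAlgebra k V :=
  LinearMap.applyₗ (v ⊗ₜ[k] 1) ∘ₗ c.braidRightAux.toLinearMap

@[simp]
theorem braidRight_one (v : V) : c.braidRight v 1 = v ⊗ₜ 1 := by
  simp [braidRight]

theorem braidRight_ι_mul (v u : V) (x : TensorAlgebra k V) :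
    c.braidRight v (ι k u * x) =
      (cons k V).lTensor V (c.act _ (u ⊗ₜ c.braidRight v x)) := by
  simp [braidRight, braidRightAux]

/-- The hexagon rule relating the braiding `T(V) ⊗ V → V ⊗ T(V)` and `leftComul`. -/
theorem leftComul_braidRight (v : V) (x : TensorAlgebra k V) :
    c.leftComul.lTensor V (c.braidRight v x) =
      c.act _ ((c.braidRight v).lTensor V (c.leftComul x)) := by
  refine linearMap_ext_cons (f := c.leftComul.lTensor V ∘ₗ c.braidRight v)
    (g := c.act _ ∘ₗ (c.braidRight v).lTensor V ∘ₗ c.leftComul) ?_ ?_ x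
  · simp
  · intro u x hx
    simp only [LinearMap.comp_apply] at hx ⊢
    have h1 : ∀ y, c.leftComul.lTensor V ((cons k V).lTensor V y) =
        y + ((cons k V).lTensor V).lTensor V ((c.act _).lTensor V
          ((c.leftComul.lTensor V).lTensor V y)) := by
      intro y
      have : c.leftComul ∘ₗ cons k V = LinearMap.id +
          (cons k V).lTensor V ∘ₗ c.act _ ∘ₗ c.leftComul.lTensor V :=
        LinearMap.ext c.leftComul_cons
      simp only [← LinearMap.lTensor_comp_apply, this,
        LinearMap.lTensor_add, LinearMap.add_apply, LinearMap.lTensor_id, LinearMap.id_apply]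
    have h2 : ∀ y, (c.braidRight v).lTensor V ((cons k V).lTensor V y) =
        ((cons k V).lTensor V).lTensor V ((c.act _).lTensor V
          (((c.braidRight v).lTensor V).lTensor V y)) := by
      intro y
      have : c.braidRight v ∘ₗ cons k V =
          (cons k V).lTensor V ∘ₗ c.act _ ∘ₗ (c.braidRight v).lTensor V := by
        ext u x
        simp [braidRight_ι_mul]
      simp only [← LinearMap.lTensor_comp_apply, this]
    rw [braidRight_ι_mul, h1, ← act_lTensor, LinearMap.lTensor_tmul, hx, leftComul_ι_mul,
      map_add, map_add, LinearMap.lTensor_tmul, h2, act_lTensor c (cons k V),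
      ← act_lTensor c (c.braidRight v), LinearMap.lTensor_tmul, act_braid, LinearMap.lTensor_tmul]

/-- Leibniz rule for the last letter: the letter split off comes either from `x` or is `v` itself,
which must then be braided leftwards past all of `x`. -/
theorem leftComul_mul_ι (x : TensorAlgebra k V) (v : V) :
    c.leftComul (x * ι k v) =
      (LinearMap.mulRight k (ι k v)).lTensor V (c.leftComul x) + c.braidRight v x := by
  refine linearMap_ext_cons (f := c.leftComul ∘ₗ LinearMap.mulRight k (ι k v))
    (g := (LinearMap.mulRight k (ι k v)).lTensor V ∘ₗ c.leftComul + c.braidRight v) ?_ ?_ x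
  · have := c.leftComul_ι_mul v 1
    rw [mul_one] at this
    simp [this]
  · intro u x hx
    simp only [LinearMap.comp_apply, LinearMap.add_apply, LinearMap.mulRight_apply] at hx ⊢
    have h : LinearMap.mulRight k (ι k v) ∘ₗ cons k V =
        cons k V ∘ₗ (LinearMap.mulRight k (ι k v)).lTensor V := by
      ext u x
      simp [mul_assoc]
    have hn := c.act_lTensor (LinearMap.mulRight k (ι k v)) (u ⊗ₜ c.leftComul x)
    rw [LinearMap.lTensor_tmul] at hn
    rw [mul_assoc, leftComul_ι_mul, hx, leftComul_ι_mul, braidRight_ι_mul, tmul_add, map_add,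
      map_add, map_add, hn, ← LinearMap.lTensor_comp_apply, ← LinearMap.lTensor_comp_apply, h,
      LinearMap.lTensor_tmul, LinearMap.mulRight_apply]
    abel

end Braiding

/-! ### A criterion for membership in `M ⊗ X + X ⊗ M`. -/

namespace TensorProduct

variable {k X : Type*} [Field k] [AddCommGroup X] [Module k X]

theorem comm_lTensor {Y Z : Type*} [AddCommGroup Y] [Module k Y] [AddCommGroup Z] [Module k Z]
    (f : Y →ₗ[k] Z) (w : X ⊗[k] Y) :
    TensorProduct.comm k X Z (f.lTensor X w) = f.rTensor X (TensorProduct.comm k X Y w) := by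
  induction w with
  | zero => simp
  | add a b ha hb => simp only [map_add, ha, hb]
  | tmul a b => simp

/-- A tensor in `X ⊗ X` lies in `M ⊗ X + X ⊗ M` if contracting its right factor with linear forms
vanishing on `M` gives elements of `M`. -/
theorem mem_range_rTensor_sup_lTensor (M : Submodule k X) (w : X ⊗[k] X)
    (h : ∀ g : Module.Dual k X, M ≤ LinearMap.ker g →
      slice X g (TensorProduct.comm k X X w) ∈ M) :
    w ∈ LinearMap.range (M.subtype.rTensor X) ⊔ LinearMap.range (M.subtype.lTensor X) := by
  -- Forms vanishing on `M` are the forms on `X ⧸ M`, so the flipped tensor has image in `(X ⧸ M) ⊗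
  -- M`.
  have h1 : M.mkQ.rTensor X (TensorProduct.comm k X X w) ∈
      LinearMap.range (M.subtype.lTensor (X ⧸ M)) := by
    rw [mem_range_lTensor_iff]
    intro f
    have := h (f ∘ₗ M.mkQ) fun x hx => by simp [(Submodule.Quotient.mk_eq_zero M).2 hx]
    simpa [slice, LinearMap.rTensor_comp] using this
  obtain ⟨y, hy⟩ := h1
  obtain ⟨y, rfl⟩ := LinearMap.rTensor_surjective M M.mkQ_surjective y
  -- After lifting to `X ⊗ M` and flipping back, the difference dies in `X ⊗ (X ⧸ M)`.
  have h2 : w - TensorProduct.comm k X X (M.subtype.lTensor X y) ∈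
      LinearMap.range (M.subtype.lTensor X) := by
    rw [← lTensor_mkQ, LinearMap.mem_ker, ← (TensorProduct.comm k X (X ⧸ M)).map_eq_zero_iff,
      comm_lTensor, map_sub, TensorProduct.comm_comm, map_sub, ← hy, sub_eq_zero,
      ← LinearMap.comp_apply, ← LinearMap.comp_apply, LinearMap.lTensor_comp_rTensor,
      LinearMap.rTensor_comp_lTensor]
  rw [← sub_add_cancel w (TensorProduct.comm k X X (M.subtype.lTensor X y)), add_comm]
  refine Submodule.add_mem_sup ⟨TensorProduct.comm k X M y, ?_⟩ h2
  rw [comm_lTensor]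

end TensorProduct

/-! ### The grading of `T(V)` by recursion on the first letter. -/

namespace TensorAlgebra
variable {k V : Type*} [Field k] [AddCommGroup V] [Module k V]

/-- The projection of `T(V)` to its homogeneous component of degree `n`. -/
def proj (n : ℕ) : TensorAlgebra k V →ₗ[k] TensorAlgebra k V :=
  GradedAlgebra.proj (fun n : ℕ => LinearMap.range (ι k : V →ₗ[k] _) ^ n) n

theorem ι_mem_range_pow_one (v : V) :
    ι k v ∈ LinearMap.range (ι k : V →ₗ[k] _) ^ 1 := by
  rw [pow_one]
  exact ⟨v, rfl⟩

theorem proj_zero_one : proj 0 (1 : TensorAlgebra k V) = 1 := by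
  rw [proj, GradedAlgebra.proj_apply]
  exact DirectSum.decompose_of_mem_same _ SetLike.GradedOne.one_mem

theorem proj_succ_one (n : ℕ) : proj (n + 1) (1 : TensorAlgebra k V) = 0 := by
  rw [proj, GradedAlgebra.proj_apply]
  exact DirectSum.decompose_of_mem_ne _ SetLike.GradedOne.one_mem (Nat.succ_ne_zero n).symm

theorem proj_succ_ι_mul (n : ℕ) (v : V) (x : TensorAlgebra k V) :
    proj (n + 1) (ι k v * x) = ι k v * proj n x := by
  rw [proj, proj, GradedAlgebra.proj_apply, add_comm]
  exact DirectSum.coe_decompose_mul_add_of_left_mem _ (ι_mem_range_pow_one v)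

theorem proj_zero_ι_mul (v : V) (x : TensorAlgebra k V) : proj 0 (ι k v * x) = 0 := by
  rw [proj, GradedAlgebra.proj_apply]
  exact DirectSum.coe_decompose_mul_of_left_mem_of_not_le _ (ι_mem_range_pow_one v) (by simp)

theorem algebraMapInv_proj_zero (x : TensorAlgebra k V) :
    algebraMapInv (proj 0 x) = algebraMapInv x :=
  linearMap_ext_cons (f := algebraMapInv.toLinearMap ∘ₗ proj 0)
    (g := algebraMapInv.toLinearMap) (by simp [proj_zero_one])
    (fun v x _ => by simp [proj_zero_ι_mul]) x

theorem algebraMapInv_proj_succ (n : ℕ) (x : TensorAlgebra k V) :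
    algebraMapInv (proj (n + 1) x) = 0 :=
  linearMap_ext_cons (f := algebraMapInv.toLinearMap ∘ₗ proj (n + 1))
    (g := 0) (by simp [proj_succ_one])
    (fun v x _ => by simp [proj_succ_ι_mul]) x

theorem projOne_proj_one (x : TensorAlgebra k V) : projOne k V (proj 1 x) = projOne k V x :=
  linearMap_ext_cons (f := projOne k V ∘ₗ proj 1)
    (g := projOne k V) (by simp [proj_succ_one])
    (fun v x _ => by simp [proj_succ_ι_mul, algebraMapInv_proj_zero]) x

end TensorAlgebra

/-! ### The ideal `J(V)` as the largest subspace stable under skew derivations. -/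

namespace Braiding

open TensorAlgebra TensorProduct

variable {k V : Type*} [Field k] [AddCommGroup V] [Module k V] (c : Braiding k V)

/-- A subspace of the augmentation ideal of `T(V)` that is stable under all skew derivations. -/
structure IsSkewStable (M : Submodule k (TensorAlgebra k V)) : Prop where
  counit : M ≤ LinearMap.ker algebraMapInv.toLinearMap
  skew : ∀ f : Module.Dual k V, M ≤ M.comap (slice _ f ∘ₗ c.leftComul)

/-- The largest subspace of the augmentation ideal of `T(V)` that is stable under all skew
derivations. -/
def skewKernel : Submodule k (TensorAlgebra k V) := sSup {M | c.IsSkewStable M}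

theorem IsSkewStable.le {c : Braiding k V} {M : Submodule k (TensorAlgebra k V)}
    (h : c.IsSkewStable M) : M ≤ c.skewKernel :=
  le_sSup h

theorem isSkewStable_skewKernel : c.IsSkewStable c.skewKernel where
  counit := sSup_le fun _ hM => hM.counit
  skew f := sSup_le fun _ hM => (hM.skew f).trans (Submodule.comap_mono hM.le)

theorem algebraMapInv_of_mem {x : TensorAlgebra k V} (hx : x ∈ c.skewKernel) :
    algebraMapInv x = 0 :=
  c.isSkewStable_skewKernel.counit hx

theorem leftComul_mem_range {x : TensorAlgebra k V} (hx : x ∈ c.skewKernel) :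
    c.leftComul x ∈ LinearMap.range (c.skewKernel.subtype.lTensor V) :=
  (mem_range_lTensor_iff _ _).2 fun f => c.isSkewStable_skewKernel.skew f hx

theorem slice_leftComul_mem {x : TensorAlgebra k V} (hx : x ∈ c.skewKernel)
    (f : Module.Dual k V) : slice _ f (c.leftComul x) ∈ c.skewKernel :=
  c.isSkewStable_skewKernel.skew f hx

/-- With `K` the skew kernel, `K + VK` is stable: by the Leibniz rule `∂_f (v x)` is `f(v) x` plus
an element of `VK`. Maximality gives `VK ⊆ K`. -/
theorem ι_mul_mem_skewKernel (v : V) {x : TensorAlgebra k V} (hx : x ∈ c.skewKernel) :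
    ι k v * x ∈ c.skewKernel := by
  suffices h : c.IsSkewStable (c.skewKernel ⊔
      LinearMap.range (cons k V ∘ₗ c.skewKernel.subtype.lTensor V)) from
    h.le (Submodule.mem_sup_right ⟨v ⊗ₜ ⟨x, hx⟩, by simp⟩)
  refine ⟨sup_le c.isSkewStable_skewKernel.counit ?_, fun f => sup_le ?_ ?_⟩
  · rintro _ ⟨y, rfl⟩
    induction y with
    | zero => simp
    | add a b ha hb => rw [map_add]; exact Submodule.add_mem _ ha hb
    | tmul v x => simp
  · exact (c.isSkewStable_skewKernel.skew f).trans (Submodule.comap_mono le_sup_left)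
  · rintro _ ⟨y, rfl⟩
    induction y with
    | zero => simp
    | add a b ha hb => rw [map_add]; exact Submodule.add_mem _ ha hb
    | tmul v x =>
      obtain ⟨y, hy⟩ := c.leftComul_mem_range x.2
      simp only [LinearMap.comp_apply, LinearMap.lTensor_tmul, cons_tmul, Submodule.mem_comap,
        leftComul_ι_mul, Submodule.subtype_apply, map_add, slice_tmul, slice_lTensor]
      refine Submodule.add_mem_sup (Submodule.smul_mem _ _ x.2)
        ⟨slice _ f (c.act _ (v ⊗ₜ y)), ?_⟩
      rw [← hy, ← LinearMap.lTensor_tmul, act_lTensor, slice_lTensor, LinearMap.comp_apply]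

theorem algebraMapInv_slice_braidRight (f : Module.Dual k V) (v : V) (x : TensorAlgebra k V) :
    algebraMapInv (slice _ f (c.braidRight v x)) = f v * algebraMapInv x := by
  refine linearMap_ext_cons
    (f := algebraMapInv.toLinearMap ∘ₗ slice _ f ∘ₗ c.braidRight v)
    (g := f v • algebraMapInv.toLinearMap) ?_ ?_ x
  · simp
  · intro u x _
    have h : ∀ z, algebraMapInv (cons k V z) = 0 := by
      intro z
      induction z with
      | zero => simp
      | add a b ha hb => simp only [map_add, ha, hb, add_zero]
      | tmul v x => simp
    simp [braidRight_ι_mul, slice_lTensor, h]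

theorem slice_braidRight_mem (f : Module.Dual k V) (v : V) {x : TensorAlgebra k V}
    (hx : x ∈ c.skewKernel) : slice _ f (c.braidRight v x) ∈ c.skewKernel := by
  -- `N` is spanned by all contractions of the braidings `c (x ⊗ v)` with `x` in the skew kernel.
  -- The hexagon rule puts `leftComul` of such braidings in `V ⊗ V ⊗ N`, so `N` is stable.
  obtain ⟨N, hN⟩ : ∃ N : Submodule k (TensorAlgebra k V), N = ⨆ (f : Module.Dual k V) (v : V),
    c.skewKernel.map (slice _ f ∘ₗ c.braidRight v) := ⟨_, rfl⟩
  have hmem : ∀ f v, ∀ x ∈ c.skewKernel, slice _ f (c.braidRight v x) ∈ N := by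
    intro f v x hx
    rw [hN]
    exact Submodule.mem_iSup_of_mem f (Submodule.mem_iSup_of_mem v ⟨x, hx, rfl⟩)
  have hle : ∀ N', (∀ f v, ∀ x ∈ c.skewKernel, slice _ f (c.braidRight v x) ∈ N') → N ≤ N' := by
    intro N' h
    rw [hN]
    refine iSup_le fun f => iSup_le fun v => ?_
    rintro _ ⟨x, hx, rfl⟩
    exact h f v x hx
  suffices h : c.IsSkewStable N from h.le (hmem f v x hx)
  refine ⟨hle _ fun f v x hx => ?_, fun g => hle _ fun f v x hx => ?_⟩
  · simp [algebraMapInv_slice_braidRight, c.algebraMapInv_of_mem hx]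
  · obtain ⟨y, hy⟩ := c.leftComul_mem_range hx
    rw [Submodule.mem_comap, LinearMap.comp_apply, ← slice_lTensor, leftComul_braidRight, ← hy]
    clear hy
    induction y with
    | zero => simp
    | add a b ha hb => simp only [map_add]; exact Submodule.add_mem _ ha hb
    | tmul u x =>
      obtain ⟨w, hw⟩ := (mem_range_lTensor_iff N (c.braidRight v x)).2 fun f => hmem f v _ x.2
      rw [LinearMap.lTensor_tmul, LinearMap.lTensor_tmul, Submodule.subtype_apply, ← hw,
        ← LinearMap.lTensor_tmul, act_lTensor, slice_lTensor, slice_lTensor]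
      exact Subtype.coe_prop _

theorem mul_ι_mem_skewKernel (v : V) {x : TensorAlgebra k V} (hx : x ∈ c.skewKernel) :
    x * ι k v ∈ c.skewKernel := by
  suffices h : c.IsSkewStable (c.skewKernel ⊔
      c.skewKernel.map (LinearMap.mulRight k (ι k v))) from
    h.le (Submodule.mem_sup_right ⟨x, hx, rfl⟩)
  refine ⟨sup_le c.isSkewStable_skewKernel.counit ?_, fun f => sup_le ?_ ?_⟩
  · rintro _ ⟨y, _, rfl⟩
    simp
  · exact (c.isSkewStable_skewKernel.skew f).trans (Submodule.comap_mono le_sup_left)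
  · rintro _ ⟨y, hy, rfl⟩
    rw [Submodule.mem_comap, LinearMap.comp_apply, LinearMap.mulRight_apply, leftComul_mul_ι,
      map_add, slice_lTensor, add_comm]
    exact Submodule.add_mem_sup (c.slice_braidRight_mem f v hy)
      ⟨_, c.slice_leftComul_mem hy f, rfl⟩

theorem leftComul_proj_zero (x : TensorAlgebra k V) : c.leftComul (proj 0 x) = 0 :=
  linearMap_ext_cons (f := c.leftComul ∘ₗ proj 0) (g := 0) (by simp [proj_zero_one])
    (fun v x _ => by simp [proj_zero_ι_mul]) x

theorem leftComul_proj_succ (n : ℕ) : ∀ x : TensorAlgebra k V,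
    c.leftComul (proj (n + 1) x) = (proj n).lTensor V (c.leftComul x) := by
  have hs : ∀ n, proj (n + 1) ∘ₗ cons k V = cons k V ∘ₗ (proj n).lTensor V := by
    intro n; ext v x; simp [proj_succ_ι_mul]
  have h0 : proj 0 ∘ₗ cons k V = 0 := by ext v x; simp [proj_zero_ι_mul]
  induction n with
  | zero =>
    refine linearMap_ext_cons (f := c.leftComul ∘ₗ proj (0 + 1))
      (g := (proj 0).lTensor V ∘ₗ c.leftComul) (by simp [proj_succ_one]) fun v x _ => ?_
    simp only [LinearMap.comp_apply]
    rw [proj_succ_ι_mul, leftComul_ι_mul, leftComul_ι_mul, leftComul_proj_zero, map_add,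
      ← LinearMap.lTensor_comp_apply, h0]
    simp
  | succ n ih =>
    refine linearMap_ext_cons (f := c.leftComul ∘ₗ proj (n + 1 + 1))
      (g := (proj (n + 1)).lTensor V ∘ₗ c.leftComul) (by simp [proj_succ_one]) fun v x _ => ?_
    simp only [LinearMap.comp_apply]
    rw [proj_succ_ι_mul, leftComul_ι_mul, leftComul_ι_mul, ih, map_add,
      ← LinearMap.lTensor_comp_apply, hs, LinearMap.lTensor_comp_apply, ← act_lTensor,
      LinearMap.lTensor_tmul, LinearMap.lTensor_tmul]

/-- Skew derivations lower the degree by one, so the span of the homogeneous components of the skew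
kernel is again stable. -/
theorem proj_mem_skewKernel (n : ℕ) {x : TensorAlgebra k V} (hx : x ∈ c.skewKernel) :
    proj n x ∈ c.skewKernel := by
  suffices h : c.IsSkewStable (⨆ n, c.skewKernel.map (proj n)) from
    h.le (Submodule.mem_iSup_of_mem n ⟨x, hx, rfl⟩)
  refine ⟨iSup_le fun n => ?_, fun f => iSup_le fun n => ?_⟩
  · rintro _ ⟨x, hx, rfl⟩
    cases n with
    | zero => simp [algebraMapInv_proj_zero, c.algebraMapInv_of_mem hx]
    | succ n => simp [algebraMapInv_proj_succ]
  · rintro _ ⟨x, hx, rfl⟩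
    rw [Submodule.mem_comap, LinearMap.comp_apply]
    cases n with
    | zero => simp [leftComul_proj_zero]
    | succ n =>
      rw [leftComul_proj_succ, slice_lTensor]
      exact Submodule.mem_iSup_of_mem n ⟨_, c.slice_leftComul_mem hx f, rfl⟩

/-- For `g` vanishing on the skew kernel `K`, the space `(id ⊗ g) Δ(K)` is stable and hence inside
`K`: its counit is `g(K) = 0`, and by coassociativity `∂_f` commutes with `(id ⊗ g) Δ`. -/
theorem comul_mem_of_mem_skewKernel {x : TensorAlgebra k V} (hx : x ∈ c.skewKernel) :
    c.comul x ∈ LinearMap.range (c.skewKernel.subtype.rTensor (TensorAlgebra k V)) ⊔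
      LinearMap.range (c.skewKernel.subtype.lTensor (TensorAlgebra k V)) := by
  refine mem_range_rTensor_sup_lTensor _ _ fun g hg => ?_
  suffices h : c.IsSkewStable (c.skewKernel.map (slice _ g ∘ₗ
      (TensorProduct.comm k _ _).toLinearMap ∘ₗ c.comul)) from h.le ⟨x, hx, rfl⟩
  constructor
  · rintro _ ⟨x, hx, rfl⟩
    have h : ∀ z : TensorAlgebra k V ⊗[k] TensorAlgebra k V,
        algebraMapInv (slice _ g (TensorProduct.comm k _ _ z)) =
        g (slice _ algebraMapInv.toLinearMap z) := by
      intro z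
      induction z with
      | zero => simp
      | add a b ha hb => simp only [map_add, ha, hb]
      | tmul a b => simp [mul_comm]
    simpa [h, counit_comul] using hg hx
  · rintro f _ ⟨x, hx, rfl⟩
    have h : ∀ z, slice _ f (c.leftComul (slice _ g (TensorProduct.comm k _ _ z))) =
        slice _ g (TensorProduct.comm k _ _ (slice _ f (c.leftComulTensor _ z))) := by
      intro z
      induction z with
      | zero => simp
      | add a b ha hb => simp only [map_add, ha, hb]
      | tmul a b => simp [leftComulTensor_tmul, slice_lTensor]
    refine ⟨_, c.slice_leftComul_mem hx f, ?_⟩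
    simp only [LinearMap.comp_apply, LinearEquiv.coe_coe, h, leftComulTensor_comul, slice_lTensor]

/-- The skew kernel as an ideal of `T(V)`. -/
def skewIdeal : Ideal (TensorAlgebra k V) where
  __ := c.skewKernel
  smul_mem' a x hx := by
    change a * x ∈ c.skewKernel
    revert x
    induction a using TensorAlgebra.induction with
    | algebraMap r =>
      intro x hx
      rw [← Algebra.smul_def]
      exact c.skewKernel.smul_mem r hx
    | ι v => exact fun x hx => c.ι_mul_mem_skewKernel v hx
    | mul a b ha hb => intro x hx; rw [mul_assoc]; exact ha _ (hb _ hx)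
    | add a b ha hb => intro x hx; rw [add_mul]; exact Submodule.add_mem _ (ha _ hx) (hb _ hx)

theorem mem_skewIdeal {x : TensorAlgebra k V} : x ∈ c.skewIdeal ↔ x ∈ c.skewKernel := Iff.rfl

theorem isNicholsIdeal_skewIdeal : c.IsNicholsIdeal c.skewIdeal where
  isTwoSided := ⟨fun {a} b ha => by
    rw [mem_skewIdeal] at ha ⊢
    revert a
    induction b using TensorAlgebra.induction with
    | algebraMap r =>
      intro x hx
      rw [← Algebra.commutes, ← Algebra.smul_def]
      exact c.skewKernel.smul_mem r hx
    | ι v => exact fun hx => c.mul_ι_mem_skewKernel v hx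
    | mul a b ha hb => intro x hx; rw [← mul_assoc]; exact hb (ha hx)
    | add a b ha hb => intro x hx; rw [mul_add]; exact Submodule.add_mem _ (ha hx) (hb hx)⟩
  isHomogeneous n x hx := c.proj_mem_skewKernel n hx
  comul_mem x hx := c.comul_mem_of_mem_skewKernel hx
  disjoint := by
    rw [Submodule.disjoint_def]
    intro x hx hx'
    replace hx : x ∈ c.skewKernel := hx
    obtain ⟨_, ⟨r, rfl⟩, _, ⟨v, rfl⟩, rfl⟩ := Submodule.mem_sup.1 hx'
    have hr : r = 0 := by simpa using c.algebraMapInv_of_mem hx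
    rw [hr, map_zero, zero_add] at hx ⊢
    suffices hv : v = 0 by rw [hv, map_zero]
    -- Here `∂_f v = f(v) · 1` lies in the augmentation ideal, which forces `f(v) = 0` for every
    -- `f`.
    refine (Module.forall_dual_apply_eq_zero_iff k v).1 fun f => ?_
    have h := c.leftComul_ι_mul v 1
    rw [mul_one, leftComul_one, tmul_zero, map_zero, map_zero, add_zero] at h
    simpa [h] using c.algebraMapInv_of_mem (c.slice_leftComul_mem hx f)

/-- A homogeneous ideal meeting `k ⊕ V` trivially has no parts of degree zero or one. So `projOne`
kills the summand `I ⊗ T(V)` and sends `T(V) ⊗ I` into `V ⊗ I`. -/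
theorem IsNicholsIdeal.isSkewStable {c : Braiding k V} {I : Ideal (TensorAlgebra k V)}
    (hI : c.IsNicholsIdeal I) : c.IsSkewStable (I.restrictScalars k) := by
  have h0 : ∀ x ∈ I, proj 0 x = 0 := fun x hx =>
    Submodule.disjoint_def.1 hI.disjoint _ (hI.isHomogeneous 0 hx)
      (Submodule.mem_sup_left (by
        rw [← pow_zero (LinearMap.range (ι k : V →ₗ[k] _))]
        exact SetLike.coe_mem _))
  have h1 : ∀ x ∈ I, proj 1 x = 0 := fun x hx =>
    Submodule.disjoint_def.1 hI.disjoint _ (hI.isHomogeneous 1 hx)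
      (Submodule.mem_sup_right (by
        exact (pow_one (LinearMap.range (ι k : V →ₗ[k] TensorAlgebra k V))).le
          (SetLike.coe_mem _)))
  constructor
  · intro x hx
    change algebraMapInv x = 0
    rw [← algebraMapInv_proj_zero, h0 x hx, map_zero]
  · intro f x hx
    obtain ⟨_, ⟨y, rfl⟩, _, ⟨z, rfl⟩, h⟩ := Submodule.mem_sup.1 (hI.comul_mem x hx)
    have hp : projOne k V ∘ₗ (I.restrictScalars k).subtype = 0 := by
      ext ⟨x, hx⟩
      change projOne k V x = 0
      rw [← projOne_proj_one, h1 x hx, map_zero]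
    have hz : (projOne k V).rTensor _ ((I.restrictScalars k).subtype.lTensor _ z) =
        (I.restrictScalars k).subtype.lTensor _ ((projOne k V).rTensor _ z) := by
      rw [← LinearMap.comp_apply, ← LinearMap.comp_apply, LinearMap.rTensor_comp_lTensor,
        LinearMap.lTensor_comp_rTensor]
    rw [Submodule.mem_comap, LinearMap.comp_apply, leftComul, LinearMap.comp_apply, ← h, map_add,
      ← LinearMap.rTensor_comp_apply, hp, LinearMap.rTensor_zero, LinearMap.zero_apply, zero_add,
      hz, slice_lTensor]
    exact Subtype.coe_prop _

theorem relationIdeal_eq_skewIdeal : c.relationIdeal = c.skewIdeal :=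
  le_antisymm (sSup_le fun _ hI _ hx => hI.isSkewStable.le hx)
    (le_sSup c.isNicholsIdeal_skewIdeal)

theorem mem_relationIdeal_iff {x : TensorAlgebra k V} :
    x ∈ c.relationIdeal ↔ x ∈ c.skewKernel := by
  rw [relationIdeal_eq_skewIdeal, mem_skewIdeal]

end Braiding

theorem TensorProduct.slice_map {k V W X Y : Type*} [Field k] [AddCommGroup V] [Module k V]
    [AddCommGroup W] [Module k W] [AddCommGroup X] [Module k X] [AddCommGroup Y] [Module k Y]
    (f : Module.Dual k V) (h : W →ₗ[k] V) (g : X →ₗ[k] Y) (z : W ⊗[k] X) :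
    slice Y f (TensorProduct.map h g z) = g (slice X (f ∘ₗ h) z) := by
  induction z with
  | zero => simp
  | add a b ha hb => simp only [map_add, ha, hb]
  | tmul a b => simp

/-! ### Tensor algebras of subspaces. -/

namespace TensorAlgebra

variable {k V : Type*} [Field k] [AddCommGroup V] [Module k V]

@[simp]
theorem inclusion_ι (W : Submodule k V) (w : W) : inclusion W (ι k w) = ι k (w : V) := by
  simp [inclusion]

@[simp]
theorem algebraMapInv_inclusion (W : Submodule k V) (x : TensorAlgebra k W) :
    algebraMapInv (inclusion W x) = algebraMapInv x := by
  have : (algebraMapInv : TensorAlgebra k V →ₐ[k] k).comp (inclusion W) = algebraMapInv := by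
    ext w
    simp
  exact DFunLike.congr_fun this x

theorem range_inclusion_mono {U W : Submodule k V} (h : U ≤ W) :
    (inclusion U).range ≤ (inclusion W).range := by
  rintro _ ⟨x, rfl⟩
  refine ⟨lift k (ι k ∘ₗ Submodule.inclusion h) x, ?_⟩
  have : (inclusion W).comp (lift k (ι k ∘ₗ Submodule.inclusion h)) = inclusion U := by
    ext w
    simp
  exact DFunLike.congr_fun this x

/-- If `V` is a filtered union of subspaces `W i`, then `T(V)` is the union of the `T(W i)`. -/
theorem exists_mem_range_inclusion {α : Type*} (W : α → Submodule k V) {F : Set α}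
    (hF : ∀ a ∈ F, ∀ b ∈ F, ∃ d ∈ F, W a ≤ W d ∧ W b ≤ W d)
    (hV : ∀ v : V, ∃ a ∈ F, v ∈ W a) (x : TensorAlgebra k V) :
    ∃ a ∈ F, x ∈ (inclusion (W a)).range := by
  induction x using TensorAlgebra.induction with
  | algebraMap r =>
    -- Covering the vector `0` only serves to produce a member of `F`.
    obtain ⟨a, ha, _⟩ := hV 0
    exact ⟨a, ha, Subalgebra.algebraMap_mem _ r⟩
  | ι v =>
    obtain ⟨a, ha, hv⟩ := hV v
    exact ⟨a, ha, ι k ⟨v, hv⟩, by simp⟩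
  | mul x y hx hy =>
    obtain ⟨a, ha, hx⟩ := hx
    obtain ⟨b, hb, hy⟩ := hy
    obtain ⟨d, hd, h1, h2⟩ := hF a ha b hb
    exact ⟨d, hd, mul_mem (range_inclusion_mono h1 hx) (range_inclusion_mono h2 hy)⟩
  | add x y hx hy =>
    obtain ⟨a, ha, hx⟩ := hx
    obtain ⟨b, hb, hy⟩ := hy
    obtain ⟨d, hd, h1, h2⟩ := hF a ha b hb
    exact ⟨d, hd, add_mem (range_inclusion_mono h1 hx) (range_inclusion_mono h2 hy)⟩

end TensorAlgebra

/-! ### Gelfand-Kirillov dimension under injective maps and filtered unions. -/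

section GelfandKirillov

variable {k A B : Type*} [Field k] [Ring A] [Algebra k A] [Ring B] [Algebra k B]

/-- The growth exponent `limsup_n log (dim (k + U + ⋯ + Uⁿ)) / log n` of a subspace `U`. -/
def growthExponent (U : Submodule k A) : EReal :=
  Filter.limsup
    (fun n : ℕ => ((Real.log (Module.finrank k ↥(⨆ i ∈ Finset.range (n + 1), U ^ i)) /
      Real.log n : ℝ) : EReal)) Filter.atTop

theorem gelfandKirillovDim_eq_iSup :
    gelfandKirillovDim k A =
      ⨆ U : {U : Submodule k A // FiniteDimensional k U}, growthExponent U.1 := rfl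

theorem growthExponent_map {φ : A →ₐ[k] B} (hφ : Function.Injective φ) (U : Submodule k A) :
    growthExponent (U.map φ.toLinearMap) = growthExponent U := by
  unfold growthExponent
  congr 1
  ext n
  have : (⨆ i ∈ Finset.range (n + 1), U.map φ.toLinearMap ^ i) =
      (⨆ i ∈ Finset.range (n + 1), U ^ i).map φ.toLinearMap := by
    simp only [Submodule.map_iSup, Submodule.map_pow]
  rw [this, ← (Submodule.equivMapOfInjective φ.toLinearMap hφ _).finrank_eq]

theorem gelfandKirillovDim_le_of_injective {φ : A →ₐ[k] B} (hφ : Function.Injective φ) :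
    gelfandKirillovDim k A ≤ gelfandKirillovDim k B := by
  rw [gelfandKirillovDim_eq_iSup, gelfandKirillovDim_eq_iSup]
  refine iSup_le fun ⟨U, hU⟩ => ?_
  rw [← growthExponent_map hφ U]
  exact le_iSup (fun U : {U : Submodule k B // FiniteDimensional k U} => growthExponent U.1)
    ⟨U.map φ.toLinearMap, inferInstance⟩

/-- The Gelfand-Kirillov dimension of a filtered union of subalgebras. -/
theorem gelfandKirillovDim_eq_biSup {α : Type*} {C : α → Type*} [∀ a, Ring (C a)]
    [∀ a, Algebra k (C a)] (φ : ∀ a, C a →ₐ[k] B) (hφ : ∀ a, Function.Injective (φ a))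
    {F : Set α} (hne : F.Nonempty)
    (hF : ∀ a ∈ F, ∀ b ∈ F, ∃ d ∈ F, (φ a).range ≤ (φ d).range ∧ (φ b).range ≤ (φ d).range)
    (hB : ∀ x : B, ∃ a ∈ F, x ∈ (φ a).range) :
    gelfandKirillovDim k B = ⨆ a ∈ F, gelfandKirillovDim k (C a) := by
  refine le_antisymm ?_ (iSup₂_le fun a _ => gelfandKirillovDim_le_of_injective (hφ a))
  rw [gelfandKirillovDim_eq_iSup]
  refine iSup_le fun ⟨U, hU⟩ => ?_
  have hfin : ∀ s : Finset B, ∃ a ∈ F, (s : Set B) ⊆ (φ a).range := by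
    intro s
    classical
    induction s using Finset.induction_on with
    | empty => obtain ⟨a, ha⟩ := hne; exact ⟨a, ha, by simp⟩
    | insert x s _ ih =>
      obtain ⟨a, ha, hx⟩ := hB x
      obtain ⟨b, hb, hs⟩ := ih
      obtain ⟨d, hd, h1, h2⟩ := hF a ha b hb
      refine ⟨d, hd, ?_⟩
      rw [Finset.coe_insert]
      exact Set.insert_subset (h1 hx) fun y hy => h2 (hs hy)
  obtain ⟨s, rfl⟩ := (Submodule.fg_iff_finiteDimensional U).2 hU
  obtain ⟨a, ha, hs⟩ := hfin s
  have hle : Submodule.span k (s : Set B) ≤ LinearMap.range (φ a).toLinearMap :=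
    Submodule.span_le.2 hs
  refine le_trans ?_ (le_iSup₂_of_le a ha le_rfl)
  -- The finitely many generators lie in one range, so `U` is the image of its preimage in `C a`,
  -- which is finite-dimensional by injectivity and has the same growth.
  have hmap := Submodule.map_comap_eq_of_le hle
  have hfd : FiniteDimensional k
      ((Submodule.span k (s : Set B)).comap (φ a).toLinearMap) := by
    refine FiniteDimensional.of_injective
      ((φ a).toLinearMap.restrict (p := (Submodule.span k (s : Set B)).comap (φ a).toLinearMap)
        (q := Submodule.span k (s : Set B)) fun x hx => hx) fun x y hxy => ?_
    exact Subtype.ext (hφ a (congrArg Subtype.val hxy))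
  change growthExponent (Submodule.span k (s : Set B)) ≤ _
  rw [← hmap, growthExponent_map (hφ a), gelfandKirillovDim_eq_iSup]
  exact le_iSup (fun U : {U : Submodule k (C a) // FiniteDimensional k U} => growthExponent U.1)
    ⟨_, hfd⟩

end GelfandKirillov

/-! ### Restriction to braided subspaces and filtered unions. -/

namespace Braiding

open TensorAlgebra TensorProduct

variable {k V : Type*} [Field k] [AddCommGroup V] [Module k V] (c : Braiding k V)
variable (W : c.BraidedSubspace)

theorem act_map_subtype {X Y : Type*} [AddCommGroup X] [Module k X] [AddCommGroup Y] [Module k Y]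
    (g : X →ₗ[k] Y) (z : W.1 ⊗[k] (W.1 ⊗[k] X)) :
    c.act Y (map W.1.subtype (map W.1.subtype g) z) =
      map W.1.subtype (map W.1.subtype g) ((c.restrict W).act X z) := by
  induction z with
  | zero => simp
  | add a b ha hb => simp only [map_add, ha, hb]
  | tmul u z =>
  induction z with
  | zero => simp
  | add a b ha hb => simp only [tmul_add, map_add, ha, hb]
  | tmul v x =>
    have h := c.mapIncl_restrictEquiv W (u ⊗ₜ v)
    rw [mapIncl, map_tmul] at h
    rw [map_tmul, map_tmul, act_tmul, act_tmul, ← h]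
    change _ = map W.1.subtype (map W.1.subtype g) (LinearMap.lTensor _ _
      (c.restrictEquiv W (u ⊗ₜ v)))
    induction c.restrictEquiv W (u ⊗ₜ v) with
    | zero => simp
    | add a b ha hb => simp only [map_add, ha, hb]
    | tmul a b => simp

/-- The recursion of `leftComul` involves only the braiding, which restricts to `W`. -/
theorem leftComul_inclusion (x : TensorAlgebra k W.1) :
    c.leftComul (inclusion W.1 x) =
      map W.1.subtype (inclusion W.1).toLinearMap ((c.restrict W).leftComul x) := by
  refine linearMap_ext_cons (f := c.leftComul ∘ₗ (inclusion W.1).toLinearMap)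
    (g := map W.1.subtype (inclusion W.1).toLinearMap ∘ₗ (c.restrict W).leftComul) ?_ ?_ x
  · simp
  · intro w x hx
    simp only [LinearMap.comp_apply, AlgHom.toLinearMap_apply] at hx ⊢
    have hc : ∀ z, (cons k V).lTensor V
          (map W.1.subtype (map W.1.subtype (inclusion W.1).toLinearMap) z) =
        map W.1.subtype (inclusion W.1).toLinearMap ((cons k W.1).lTensor W.1 z) := by
      intro z
      induction z with
      | zero => simp
      | add a b ha hb => simp only [map_add, ha, hb]
      | tmul u z =>
      induction z with
      | zero => simp
      | add a b ha hb => simp only [tmul_add, map_add, ha, hb]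
      | tmul v x => simp
    rw [map_mul, inclusion_ι, leftComul_ι_mul, leftComul_ι_mul, hx, map_add, ← hc,
      ← act_map_subtype]
    simp

/-- Both directions use maximality. The preimage of the skew kernel of `V` is stable because each
form on `W` extends to `V`; the image of that of `W` is stable because forms on `V` restrict to `W`.
-/
theorem inclusion_mem_skewKernel_iff (x : TensorAlgebra k W.1) :
    inclusion W.1 x ∈ c.skewKernel ↔ x ∈ (c.restrict W).skewKernel := by
  constructor
  · intro hx
    suffices h : (c.restrict W).IsSkewStable
        (c.skewKernel.comap (inclusion W.1).toLinearMap) from h.le hx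
    refine ⟨fun y hy => ?_, fun f y hy => ?_⟩
    · simpa using c.algebraMapInv_of_mem hy
    · obtain ⟨g, rfl⟩ := LinearMap.exists_extend f
      have := c.slice_leftComul_mem hy g
      rwa [AlgHom.toLinearMap_apply, leftComul_inclusion, slice_map] at this
  · intro hx
    suffices h : c.IsSkewStable
        ((c.restrict W).skewKernel.map (inclusion W.1).toLinearMap) from h.le ⟨x, hx, rfl⟩
    refine ⟨?_, fun f => ?_⟩
    · rintro _ ⟨y, hy, rfl⟩
      simpa using (c.restrict W).algebraMapInv_of_mem hy
    · rintro _ ⟨y, hy, rfl⟩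
      rw [Submodule.mem_comap, LinearMap.comp_apply, AlgHom.toLinearMap_apply,
        leftComul_inclusion, slice_map]
      exact ⟨_, (c.restrict W).slice_leftComul_mem hy _, rfl⟩

/-- One direction makes `B(W) → B(V)` well defined, the other makes it injective. -/
theorem inclusion_mem_relationIdeal_iff (x : TensorAlgebra k W.1) :
    inclusion W.1 x ∈ c.relationIdeal ↔ x ∈ (c.restrict W).relationIdeal := by
  rw [mem_relationIdeal_iff, mem_relationIdeal_iff, inclusion_mem_skewKernel_iff]

/-- The map `B(W) → B(V)` induced by the inclusion of a braided subspace. -/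
def nicholsInclusion : (c.restrict W).NicholsAlgebra →ₐ[k] c.NicholsAlgebra :=
  Ideal.Quotient.liftₐ _ ((Ideal.Quotient.mkₐ k c.relationIdeal).comp (inclusion W.1))
    fun x hx => Ideal.Quotient.eq_zero_iff_mem.2 ((c.inclusion_mem_relationIdeal_iff W x).2 hx)

theorem nicholsInclusion_mk (x : TensorAlgebra k W.1) :
    c.nicholsInclusion W (Ideal.Quotient.mkₐ k _ x) =
      Ideal.Quotient.mkₐ k c.relationIdeal (inclusion W.1 x) := rfl

theorem nicholsInclusion_injective : Function.Injective (c.nicholsInclusion W) := by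
  rw [injective_iff_map_eq_zero]
  intro x hx
  obtain ⟨x, rfl⟩ := Ideal.Quotient.mkₐ_surjective k _ x
  rw [nicholsInclusion_mk] at hx
  exact Ideal.Quotient.eq_zero_iff_mem.2
    ((c.inclusion_mem_relationIdeal_iff W x).1 (Ideal.Quotient.eq_zero_iff_mem.1 hx))

theorem range_nicholsInclusion :
    (c.nicholsInclusion W).range =
      (inclusion W.1).range.map (Ideal.Quotient.mkₐ k c.relationIdeal) := by
  ext y
  constructor
  · rintro ⟨x, rfl⟩
    obtain ⟨x, rfl⟩ := Ideal.Quotient.mkₐ_surjective k _ x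
    exact ⟨_, ⟨x, rfl⟩, rfl⟩
  · rintro ⟨_, ⟨x, rfl⟩, rfl⟩
    exact ⟨Ideal.Quotient.mkₐ k _ x, rfl⟩

/-- The ideal of relations, the Nichols algebra and its Gelfand-Kirillov dimension for a filtered
union of braided subspaces. -/
theorem nichols_filtered_union {F : Set c.BraidedSubspace} (hF : DirectedOn (· ≤ ·) F)
    (hV : ∀ v : V, ∃ W ∈ F, v ∈ W.1) :
    (c.relationIdeal : Set (TensorAlgebra k V)) =
        (⋃ W ∈ F, TensorAlgebra.inclusion W.1 '' (c.restrict W).relationIdeal) ∧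
      (⋃ W ∈ F, Set.range (c.nicholsInclusion W)) = Set.univ ∧
      gelfandKirillovDim k c.NicholsAlgebra =
        ⨆ W ∈ F, gelfandKirillovDim k (c.restrict W).NicholsAlgebra := by
  have hT := exists_mem_range_inclusion (fun W : c.BraidedSubspace => W.1) hF hV
  have hB : ∀ x : c.NicholsAlgebra, ∃ W ∈ F, x ∈ (c.nicholsInclusion W).range := by
    intro x
    obtain ⟨x, rfl⟩ := Ideal.Quotient.mkₐ_surjective k _ x
    obtain ⟨W, hW, hx⟩ := hT x
    refine ⟨W, hW, ?_⟩
    rw [range_nicholsInclusion]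
    exact ⟨x, hx, rfl⟩
  refine ⟨?_, ?_, ?_⟩
  · ext x
    simp only [SetLike.mem_coe, Set.mem_iUnion, Set.mem_image, exists_prop]
    constructor
    · intro hx
      obtain ⟨W, hW, y, rfl⟩ := hT x
      exact ⟨W, hW, y, (c.inclusion_mem_relationIdeal_iff W y).1 hx, rfl⟩
    · rintro ⟨W, _, y, hy, rfl⟩
      exact (c.inclusion_mem_relationIdeal_iff W y).2 hy
  · refine Set.eq_univ_of_forall fun x => ?_
    obtain ⟨W, hW, hx⟩ := hB x
    exact Set.mem_iUnion₂.2 ⟨W, hW, hx⟩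
  · obtain ⟨W₀, hW₀, _⟩ := hV 0
    refine gelfandKirillovDim_eq_biSup c.nicholsInclusion c.nicholsInclusion_injective
      ⟨W₀, hW₀⟩ (fun U hU W hW => ?_) hB
    obtain ⟨Z, hZ, h1, h2⟩ := hF U hU W hW
    simp only [range_nicholsInclusion]
    exact ⟨Z, hZ, Subalgebra.map_mono (range_inclusion_mono h1),
      Subalgebra.map_mono (range_inclusion_mono h2)⟩

end Braiding

end

theorem lemma3p5 {k V : Type*} [Field k] [AddCommGroup V] [Module k V] (c : Braiding k V) :
    -- the embeddings `B(W) ↪ B(V)` that are the inclusion on `W`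
    ∃ φ : (W : c.BraidedSubspace) → (c.restrict W).NicholsAlgebra →ₐ[k] c.NicholsAlgebra,
      (∀ W, Function.Injective (φ W)) ∧
      (∀ (W : c.BraidedSubspace) (w : W.1), φ W ((c.restrict W).nicholsι w) = c.nicholsι w) ∧
      -- filtered unions of braided subspaces
      (∀ F : Set c.BraidedSubspace, DirectedOn (· ≤ ·) F → (∀ v : V, ∃ W ∈ F, v ∈ W.1) →
        (c.relationIdeal : Set (TensorAlgebra k V)) =
            (⋃ W ∈ F, TensorAlgebra.inclusion W.1 '' (c.restrict W).relationIdeal) ∧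
        (⋃ W ∈ F, Set.range (φ W)) = Set.univ ∧
        gelfandKirillovDim k c.NicholsAlgebra =
            ⨆ W ∈ F, gelfandKirillovDim k (c.restrict W).NicholsAlgebra) ∧
      -- the locally finite case
      (c.IsLocallyFinite →
        (c.relationIdeal : Set (TensorAlgebra k V)) =
            (⋃ (W : c.BraidedSubspace) (_ : FiniteDimensional k W.1),
              TensorAlgebra.inclusion W.1 '' (c.restrict W).relationIdeal) ∧
        (⋃ (W : c.BraidedSubspace) (_ : FiniteDimensional k W.1), Set.range (φ W)) = Set.univ ∧
        gelfandKirillovDim k c.NicholsAlgebra =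
            ⨆ (W : c.BraidedSubspace) (_ : FiniteDimensional k W.1),
              gelfandKirillovDim k (c.restrict W).NicholsAlgebra) := by
  refine ⟨c.nicholsInclusion, c.nicholsInclusion_injective, fun W w => ?_,
    fun F hF hV => c.nichols_filtered_union hF hV, fun h => ?_⟩
  · change Ideal.Quotient.mkₐ k c.relationIdeal (TensorAlgebra.inclusion W.1 _) = _
    rw [TensorAlgebra.inclusion_ι]
    rfl
  · exact c.nichols_filtered_union h.2 h.1
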